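/- Let $d,k\ge 1$ be integers. Let $\mathrm{U}(d,\overline{\mathbb{Q}})$ be the group of $d\times d$ unitary matrices with entries in the field $\overline{\mathbb{Q}}\subseteq\mathbb{C}$ of algebraic numbers, and let $\mathrm{PU}(d,\overline{\mathbb{Q}})=\mathrm{U}(d,\overline{\mathbb{Q}})/Z(\mathrm{U}(d,\overline{\mathbb{Q}}))$ be its quotient by its center. Let $G$ be a finitely generated group that is virtually a subgroup of $\mathrm{PU}(d,\overline{\mathbb{Q}})^k$, i.e. some finite-index subgroup of $G$ embeds in the direct product of $k$ copies of $\mathrm{PU}(d,\overline{\mathbb{Q}})$. Let $\langle S\mid R\rangle$ be any presentation of $G$ with $S$ finite, let $\Sigma=S\sqcup S^{-1}$, and let $W_G\subseteq\Sigma^*$ be the word problem, i.e. the set of words over $\Sigma$ that represent the identity of $G$. Then for every real $\varepsilon>0$ there is a real $D\ge 1$ such that $W_G\in\mathsf{coR2QCFA}(D^n,\varepsilon,d,\overline{\mathbb{Q}})$; that is, there is a two-way finite automaton $M$ with quantum and classical states (2QCFA), with $d$ quantum basis states, finitely many classical states, and transition amplitudes (entries of the unitary transformations it may perform) in $\overline{\mathbb{Q}}$,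 such that for all $w\in\Sigma^*$: $M$ runs on $w$ in expected time $O(D^{|w|})$, where the implied constant does not depend on $w$; $\Pr[M\text{ accepts }w]+\Pr[M\text{ rejects }w]=1$; if $w\in W_G$ then $\Pr[M\text{ accepts }w]=1$; and if $w\notin W_G$ then $\Pr[M\text{ rejects }w]\ge 1-\varepsilon$. Here a 2QCFA has a read-only tape containing the input between a left and a right end-marker, a head that starts on the left end-marker and never leaves the tape, a finite set of classical states with a start state and distinct accepting and rejecting (halting) states, and a quantum register with basis states $q_1,\dots,q_d$ which starts in one fixed basis state. In each step, depending on the classical state and the scanned symbol, it either applies a unitary $d\times d$ matrix to the register, enters a classical state and moves its head by $-1$, $0$ or $1$; or it performs a projective measurement of the register with respect to a partition of the basis states, the new classical state and the head movement depending on the result. -/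

import Mathlib

/-! ### Unitary and projective unitary groups with algebraic entries -/

/-- The field of algebraic numbers, as a set of complex numbers. -/
def algebraicNumbers : Set ℂ := {z | IsAlgebraic ℚ z}

/-- `U(d, ℚ̄)`: the group of `d × d` unitary matrices all of whose entries are algebraic numbers. -/
def algebraicUnitaryGroup (d : ℕ) : Subgroup (Matrix.unitaryGroup (Fin d) ℂ) where
  carrier := {U | ∀ i j, (U : Matrix (Fin d) (Fin d) ℂ) i j ∈ algebraicNumbers}
  one_mem' := by
    intro i j
    show IsAlgebraic ℚ ((1 : Matrix (Fin d) (Fin d) ℂ) i j)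
    rw [Matrix.one_apply]
    split_ifs
    · exact isAlgebraic_one
    · exact isAlgebraic_zero
  mul_mem' := by
    intro U V hU hV i j
    show IsAlgebraic ℚ (((U : Matrix (Fin d) (Fin d) ℂ) * (V : Matrix (Fin d) (Fin d) ℂ)) i j)
    rw [Matrix.mul_apply]
    exact mem_algebraicClosure_iff.1 ((algebraicClosure ℚ ℂ).sum_mem fun l _ =>
      mem_algebraicClosure_iff.2 (IsAlgebraic.mul (hU i l) (hV l j)))
  inv_mem' := by
    intro U hU i j
    show IsAlgebraic ℚ ((Complex.conjAe.restrictScalars ℚ).toAlgHom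
      ((U : Matrix (Fin d) (Fin d) ℂ) j i))
    exact (hU j i).algHom _

/-- `PU(d, ℚ̄) = U(d, ℚ̄) / Z(U(d, ℚ̄))`. -/
abbrev AlgebraicPU (d : ℕ) : Type :=
  algebraicUnitaryGroup d ⧸ Subgroup.center (algebraicUnitaryGroup d)

/-- `G` is virtually a subgroup of `K`: some finite-index subgroup of `G` embeds in `K`. -/
def IsVirtuallySubgroupOf (G : Type*) [Group G] (K : Type*) [Group K] : Prop :=
  ∃ H : Subgroup G, H.FiniteIndex ∧ ∃ f : H →* K, Function.Injective f

/-! ### Word problems -/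

/-- The word problem of the group presented by `⟨S | R⟩`. The alphabet is the disjoint union of `S`
and its formal inverses: `(s, true)` is the letter `s` and `(s, false)` is the letter `s⁻¹`. A word
belongs to the language when the group element which it represents is the identity. -/
def wordProblem {S : Type*} (R : Set (FreeGroup S)) : Language (S × Bool) :=
  {w | (w.map fun a => if a.2 then PresentedGroup.of (rels := R) a.1
    else (PresentedGroup.of (rels := R) a.1)⁻¹).prod = 1}

/-! ### Two-way finite automata with quantum and classical states -/

/-- Tape symbols: the input letters and two distinct end-markers. -/
inductive TapeSymbol (A : Type*) where
  | leftEnd : TapeSymbol A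
  | letter (a : A) : TapeSymbol A
  | rightEnd : TapeSymbol A

/-- What a machine does in one step. A head movement is an element of `{-1, 0, 1}` (`SignType`).
Either a unitary transformation is applied to the register and then the machine enters a classical
state and moves its head; or the register is measured with respect to a partition of the basis
states (given as an equivalence relation, whose classes are the possible results), and the new
classical state and the head movement depend on the result. -/
inductive QAction (Q C : Type*) [Fintype Q] [DecidableEq Q] where
  | unitary (t : Matrix.unitaryGroup Q ℂ) (next : C × SignType) : QAction Q C
  | measure (B : Setoid Q) (next : Quotient B → C × SignType) : QAction Q C

/-- The possible classical effects (new state and head movement) of an action. -/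
def QAction.effects {Q C : Type*} [Fintype Q] [DecidableEq Q] : QAction Q C → Set (C × SignType)
  | .unitary _ next => {next}
  | .measure _ next => Set.range next

/-- A two-way finite automaton with quantum basis states `Q`, classical states `C` and input
alphabet `A`. The head never leaves the part of the tape between the end-markers. -/
structure TwoQCFA (Q C A : Type*) [Fintype Q] [DecidableEq Q] where
  qStart : Q
  cStart : C
  cAcc : C
  cRej : C
  acc_ne_rej : cAcc ≠ cRej
  δ : {c : C // c ≠ cAcc ∧ c ≠ cRej} → TapeSymbol A → QAction Q C
  leftEnd_move : ∀ c, ∀ o ∈ (δ c .leftEnd).effects, o.2 ≠ -1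
  rightEnd_move : ∀ c, ∀ o ∈ (δ c .rightEnd).effects, o.2 ≠ 1

/-- Superpositions over the basis states `Q`: unit vectors of `ℂ^Q` for the Euclidean norm. -/
abbrev Superposition (Q : Type*) [Fintype Q] : Type _ :=
  {ψ : EuclideanSpace ℂ Q // ‖ψ‖ = 1}

noncomputable section

namespace Superposition

variable {Q : Type*} [Fintype Q]

theorem sum_ofReal_norm_sq (ψ : Superposition Q) :
    ∑ q, ENNReal.ofReal (‖ψ.1 q‖ ^ 2) = 1 := by
  rw [← ENNReal.ofReal_sum_of_nonneg fun _ _ => by positivity, ← EuclideanSpace.norm_sq_eq, ψ.2]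
  simp

/-- The basis superposition `|q⟩`. -/
def basis [DecidableEq Q] (q : Q) : Superposition Q :=
  ⟨EuclideanSpace.single q 1, by simp⟩

/-- The result of applying a unitary matrix. -/
def applyUnitary [DecidableEq Q] (t : Matrix.unitaryGroup Q ℂ) (ψ : Superposition Q) : Superposition Q :=
  ⟨WithLp.toLp 2 ((t : Matrix Q Q ℂ).mulVec ψ.1.ofLp), by
    have h : ‖WithLp.toLp 2 ((t : Matrix Q Q ℂ).mulVec ψ.1.ofLp)‖ ^ 2 = ‖ψ.1‖ ^ 2 := by
      have key : star ((t : Matrix Q Q ℂ).mulVec ψ.1.ofLp) ⬝ᵥ (t : Matrix Q Q ℂ).mulVec ψ.1.ofLp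
          = star ψ.1.ofLp ⬝ᵥ ψ.1.ofLp := by
        rw [Matrix.star_mulVec, Matrix.dotProduct_mulVec, Matrix.vecMul_vecMul,
          ← Matrix.star_eq_conjTranspose, Matrix.UnitaryGroup.star_mul_self, Matrix.vecMul_one]
      have e : ∀ v : Q → ℂ, star v ⬝ᵥ v = ((‖WithLp.toLp 2 v‖ ^ 2 : ℝ) : ℂ) := by
        intro v
        rw [EuclideanSpace.norm_sq_eq]
        simp [dotProduct, ← Complex.normSq_eq_conj_mul_self, Complex.normSq_eq_norm_sq]
      rw [e, e] at key
      exact_mod_cast key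
    rw [ψ.2] at h
    nlinarith [norm_nonneg (WithLp.toLp 2 ((t : Matrix Q Q ℂ).mulVec ψ.1.ofLp))]⟩

/-- The distribution of the result of the measurement specified by a partition `B`: the block `r`
has probability `∑ q ∈ r, |ψ q|²`. -/
def measurePMF (B : Setoid Q) (ψ : Superposition Q) : PMF (Quotient B) :=
  (PMF.ofFintype (fun q => ENNReal.ofReal (‖ψ.1 q‖ ^ 2)) ψ.sum_ofReal_norm_sq).map (Quotient.mk B)

open Classical in
/-- The unnormalized projection of a superposition onto the block `r` of a partition. -/
def project (B : Setoid Q) (r : Quotient B) (ψ : Superposition Q) : EuclideanSpace ℂ Q :=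
  WithLp.toLp 2 fun q => if Quotient.mk B q = r then ψ.1 q else 0

open Classical in
/-- The superposition after a measurement with result `r`: the normalized projection onto `r`. The
first case only concerns results of probability zero. -/
def collapse (B : Setoid Q) (r : Quotient B) (ψ : Superposition Q) : Superposition Q :=
  if h : project B r ψ = 0 then ψ
  else ⟨((‖project B r ψ‖⁻¹ : ℝ) : ℂ) • project B r ψ, by
    have : ‖project B r ψ‖ ≠ 0 := norm_ne_zero_iff.2 h
    rw [norm_smul]
    simp [this]⟩

end Superposition

namespace TwoQCFA

variable {Q C A : Type*} [Fintype Q] [DecidableEq Q]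

/-- The transition amplitudes: the entries of the unitary transformations that may be performed. -/
def amplitudes (M : TwoQCFA Q C A) : Set ℂ :=
  {z | ∃ c γ t next, M.δ c γ = .unitary t next ∧ ∃ i j, z = (t : Matrix Q Q ℂ) i j}

/-- The content of the tape cell `i` on input `w`: cell `0` holds the left end-marker, cells
`1, …, n` hold the input, and cell `n + 1` holds the right end-marker (the values at larger `i` are
never read). -/
def tape (w : List A) (i : ℕ) : TapeSymbol A :=
  if i = 0 then .leftEnd
  else match w[i - 1]? with
    | some a => .letter a
    | none => .rightEnd

/-- The new head position. -/
def moveHead (i : ℕ) : SignType → ℕ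
  | .neg => i - 1
  | .zero => i
  | .pos => i + 1

/-- A configuration: classical state, head position, and state of the quantum register. -/
structure Config (Q C : Type*) [Fintype Q] where
  state : C
  head : ℕ
  reg : Superposition Q

/-- The configuration after a classical effect, with the new register. -/
def Config.update (cfg : Config Q C) (o : C × SignType) (ψ : Superposition Q) : Config Q C :=
  ⟨o.1, moveHead cfg.head o.2, ψ⟩

/-- The distribution of the configuration after performing an action. -/
def act (cfg : Config Q C) : QAction Q C → PMF (Config Q C)
  | .unitary t next => PMF.pure (cfg.update next (cfg.reg.applyUnitary t))
  | .measure B next =>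
      (cfg.reg.measurePMF B).map fun r => cfg.update (next r) (cfg.reg.collapse B r)

open Classical in
/-- One step of the computation on input `w`; in the accepting and rejecting states the machine has
halted. -/
def step (M : TwoQCFA Q C A) (w : List A) (cfg : Config Q C) : PMF (Config Q C) :=
  if h : cfg.state ≠ M.cAcc ∧ cfg.state ≠ M.cRej then
    act cfg (M.δ ⟨cfg.state, h⟩ (tape w cfg.head))
  else PMF.pure cfg

/-- The initial configuration. -/
def initial (M : TwoQCFA Q C A) : Config Q C :=
  ⟨M.cStart, 0, Superposition.basis M.qStart⟩

/-- The distribution of the configuration after `t` further steps. -/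
def runFrom (M : TwoQCFA Q C A) (w : List A) : ℕ → Config Q C → PMF (Config Q C)
  | 0, cfg => PMF.pure cfg
  | t + 1, cfg => (M.step w cfg).bind (M.runFrom w t)

/-- The probability that, on input `w`, the classical state after `t` steps lies in `E`. -/
def probAt (M : TwoQCFA Q C A) (w : List A) (t : ℕ) (E : Set C) : ENNReal :=
  (M.runFrom w t M.initial).toOuterMeasure {cfg | cfg.state ∈ E}

/-- The probability that `M` accepts `w`: the supremum, that is the limit, over `t` of the
probability that `M` has accepted within `t` steps. -/
def probAccept (M : TwoQCFA Q C A) (w : List A) : ENNReal := ⨆ t, M.probAt w t {M.cAcc}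

/-- The probability that `M` rejects `w`. -/
def probReject (M : TwoQCFA Q C A) (w : List A) : ENNReal := ⨆ t, M.probAt w t {M.cRej}

/-- The expected running time of `M` on `w`: `E[T] = ∑ t, Pr[T > t]`, where `T ≤ ∞` is the number
of steps until `M` halts. -/
def expectedTime (M : TwoQCFA Q C A) (w : List A) : ENNReal :=
  ∑' t, M.probAt w t {c | c ≠ M.cAcc ∧ c ≠ M.cRej}

end TwoQCFA

/-- The class of languages recognized with one-sided error `ε` (members are accepted with
certainty) by a machine with `d` quantum basis states, finitely many classical states and transition
amplitudes in `𝔸`, in expected time `O(T(n))`. The bound on the time is required for all inputs,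
including short ones. -/
def CoR2QCFA {A : Type*} (T : ℕ → ℝ) (ε : ℝ) (d : ℕ) (𝔸 : Set ℂ) : Set (Language A) :=
  {L | ∃ (C : Type) (_ : Finite C) (M : TwoQCFA (Fin d) C A),
    M.amplitudes ⊆ 𝔸 ∧
    (∃ K : ℝ, ∀ w : List A, M.expectedTime w ≤ ENNReal.ofReal (K * T w.length)) ∧
    ∀ w : List A,
      M.probAccept w + M.probReject w = 1 ∧
      (w ∈ L → M.probAccept w = 1) ∧
      (w ∉ L → ENNReal.ofReal (1 - ε) ≤ M.probReject w)}

end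

/-!
The machine runs one-sided randomized tests on the input `w`, over and over. A test failure is a
proof that `w` does not represent the identity, and leads to rejection. After each test that is
passed, the machine tosses a biased coin at each of the `n + 2` tape cells, and accepts if all
tosses succeed; otherwise it goes on to the next test.

The tests. Let `N` be the normal core of the given finite-index subgroup. A finite automaton
follows the class of the prefix in `G ⧸ N`, so that words outside `N` are rejected outright, and
each letter contributes an element of `N` depending on that class, with total contribution
conjugate to the inverse of the group element (`exists_automaton_of_normal`). Lift the components
in `PU(d)` of the contributions to unitary matrices. Then `w` is the identity iff each of the `k`
products of these matrices is central. A test prepares a unit vector `v`, applies the matrix `M`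
of the word and asks whether the register is still in the state `v`. A central `M` always passes
(`norm_apply_of_mem_center`). If `M` is not central, then a vector `|a⟩` or `(3|a⟩ + 4|b⟩)/5`
fails to be an eigenvector, and is detected with probability at least a constant times the squared
absolute value of a nonzero off-diagonal entry or a nonzero difference of diagonal entries
(`exists_test_of_notMem_center`). These are algebraic numbers in one number field, whose
denominators and conjugates grow at most exponentially in `n`; as the norm of a nonzero algebraic
integer is at least `1` in absolute value, they are at least exponentially small
(`exists_lower_bound_prod_entries`).

The coin has rational success amplitude, arbitrarily small (`exists_algebraicUnitary_coin`). So
for a word outside the language the probability of acceptance in a cycle of rounds can be made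
smaller than `ε` times that of rejection, while the expected number of rounds stays exponential in
`n`. For `d = 1` every matrix is central, there is no randomness, and the constant coin is used:
all words of `N` are accepted.

The probabilities and the expected time are treated together, as the expected payoff when each
step costs `c`, acceptance pays `α` and rejection pays `β` (`TwoQCFA.payoff`). One round yields a
recursive inequality (`TestFamily.roundPayoff_le`) for the supremum of this payoff over all the
states from which a round can start, and for a finite horizon this supremum is finite, so that the
inequality can be solved.
-/

open scoped ENNReal Matrix

/-! ### Expected payoffs of two-way automata -/

theorem PMF.tsum_pure_mul {α : Type*} (a : α) (g : α → ℝ≥0∞) :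
    ∑' b, PMF.pure a b * g b = g a := by
  classical
  rw [tsum_eq_single a]
  · simp
  · intro b hb
    simp [PMF.pure_apply, hb]

theorem PMF.tsum_map_mul {α β : Type*} (p : PMF α) (f : α → β) (g : β → ℝ≥0∞) :
    ∑' b, p.map f b * g b = ∑' a, p a * g (f a) := by
  classical
  simp only [PMF.map_apply, ← ENNReal.tsum_mul_right]
  rw [ENNReal.tsum_comm]
  refine tsum_congr fun a => ?_
  rw [tsum_eq_single (f a)]
  · simp
  · intro b hb
    simp [hb]

namespace Superposition

variable {Q : Type*} [Fintype Q]

/-- The register is in the basis state `q`, up to a phase. -/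
def IsBasis (ψ : Superposition Q) (q : Q) : Prop := ∀ r, r ≠ q → ψ.1 r = 0

theorem IsBasis.norm_apply {ψ : Superposition Q} {q : Q} (h : ψ.IsBasis q) : ‖ψ.1 q‖ = 1 := by
  have h1 : ‖ψ.1‖ ^ 2 = ‖ψ.1 q‖ ^ 2 := by
    rw [EuclideanSpace.norm_sq_eq]
    refine Finset.sum_eq_single q (fun r _ hr => ?_) (by simp)
    simp [h r hr]
  rw [ψ.2] at h1
  nlinarith [norm_nonneg (ψ.1 q)]

theorem isBasis_basis [DecidableEq Q] (q : Q) : (basis q).IsBasis q := by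
  intro r hr
  simp [basis, hr]

theorem applyUnitary_apply [DecidableEq Q] (t : Matrix.unitaryGroup Q ℂ) (ψ : Superposition Q)
    (i : Q) : (ψ.applyUnitary t).1 i = ∑ j, (t : Matrix Q Q ℂ) i j * ψ.1 j := rfl

theorem IsBasis.applyUnitary_apply [DecidableEq Q] {ψ : Superposition Q} {q : Q}
    (h : ψ.IsBasis q) (t : Matrix.unitaryGroup Q ℂ) (i : Q) :
    (ψ.applyUnitary t).1 i = (t : Matrix Q Q ℂ) i q * ψ.1 q := by
  rw [Superposition.applyUnitary_apply]
  exact Finset.sum_eq_single q (fun r _ hr => by simp [h r hr]) (by simp)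

theorem applyUnitary_mul [DecidableEq Q] (s t : Matrix.unitaryGroup Q ℂ) (ψ : Superposition Q) :
    ψ.applyUnitary (s * t) = (ψ.applyUnitary t).applyUnitary s := by
  apply Subtype.ext
  simp [applyUnitary, Matrix.mulVec_mulVec]

theorem applyUnitary_one [DecidableEq Q] (ψ : Superposition Q) : ψ.applyUnitary 1 = ψ := by
  apply Subtype.ext
  simp [applyUnitary]

/-- A complete measurement leaves the register in the basis state that was observed, provided that
this result has nonzero probability. -/
theorem isBasis_collapse (ψ : Superposition Q) {q : Q} (hq : ψ.1 q ≠ 0) :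
    (ψ.collapse ⊥ (Quotient.mk ⊥ q)).IsBasis q := by
  intro r hr
  have hne : project ⊥ (Quotient.mk ⊥ q) ψ ≠ 0 := by
    intro h0
    have := congrArg (fun v : EuclideanSpace ℂ Q => v q) h0
    simp [project] at this
    exact hq this
  have hrq : Quotient.mk (⊥ : Setoid Q) r ≠ Quotient.mk ⊥ q := fun h => hr (Quotient.exact h)
  rw [collapse, dif_neg hne]
  simp [project, hrq]

/-- The probability of observing `q` in a complete measurement. -/
noncomputable def prob (ψ : Superposition Q) (q : Q) : ℝ≥0∞ := ENNReal.ofReal (‖ψ.1 q‖ ^ 2)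

theorem sum_prob (ψ : Superposition Q) : ∑ q, ψ.prob q = 1 := ψ.sum_ofReal_norm_sq

theorem prob_le_one (ψ : Superposition Q) (q : Q) : ψ.prob q ≤ 1 := by
  rw [← ψ.sum_prob]
  exact Finset.single_le_sum (f := ψ.prob) (fun _ _ => zero_le) (Finset.mem_univ q)

theorem sum_prob_mul_ite [DecidableEq Q] (ψ : Superposition Q) (q : Q) (x y : ℝ≥0∞) :
    ∑ r, ψ.prob r * (if r = q then x else y) = ψ.prob q * x + (1 - ψ.prob q) * y := by
  rw [← Finset.add_sum_erase _ _ (Finset.mem_univ q)]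
  have h1 : ∑ r ∈ Finset.univ.erase q, ψ.prob r = 1 - ψ.prob q := by
    refine ENNReal.eq_sub_of_add_eq ((ψ.prob_le_one q).trans_lt ENNReal.one_lt_top).ne ?_
    rw [add_comm, Finset.add_sum_erase _ _ (Finset.mem_univ q), sum_prob]
  rw [if_pos rfl, ← h1, Finset.sum_mul]
  congr 1
  refine Finset.sum_congr rfl fun r hr => ?_
  rw [if_neg (Finset.ne_of_mem_erase hr)]

theorem tsum_measurePMF_mul (B : Setoid Q) (ψ : Superposition Q) (g : Quotient B → ℝ≥0∞) :
    ∑' r, ψ.measurePMF B r * g r = ∑ q, ψ.prob q * g (Quotient.mk B q) := by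
  rw [measurePMF, PMF.tsum_map_mul, tsum_fintype]
  rfl

end Superposition

/-- The complete measurement of the register in the basis states. -/
def QAction.observe {Q C : Type*} [Fintype Q] [DecidableEq Q] (next : Q → C × SignType) :
    QAction Q C :=
  .measure ⊥ (Quotient.lift next fun _ _ h => congrArg next h)

theorem QAction.effects_observe {Q C : Type*} [Fintype Q] [DecidableEq Q]
    (next : Q → C × SignType) : (QAction.observe next).effects = Set.range next := by
  ext o
  constructor
  · rintro ⟨r, rfl⟩
    induction r using Quotient.inductionOn with
    | h q => exact ⟨q, rfl⟩
  · rintro ⟨q, rfl⟩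
    exact ⟨Quotient.mk ⊥ q, rfl⟩

namespace TwoQCFA

variable {Q C A : Type*} [Fintype Q] [DecidableEq Q]

open Classical in
/-- The expected payoff within `t` steps from a configuration, when every step costs `c`, acceptance
pays `α` and rejection pays `β`. The choices `(1, 0, 0)`, `(0, 1, 0)` and `(0, 0, 1)` of
`(c, α, β)` give the expected running time and the probabilities of acceptance and rejection. -/
noncomputable def payoff (M : TwoQCFA Q C A) (w : List A) (c α β : ℝ≥0∞) :
    ℕ → Config Q C → ℝ≥0∞
  | 0, cfg => if cfg.state = M.cAcc then α else if cfg.state = M.cRej then β else 0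
  | t + 1, cfg => if cfg.state = M.cAcc then α else if cfg.state = M.cRej then β else
      c + ∑' cfg', M.step w cfg cfg' * M.payoff w c α β t cfg'

variable (M : TwoQCFA Q C A) (w : List A) (c α β : ℝ≥0∞)

theorem payoff_of_acc (t : ℕ) {cfg : Config Q C} (h : cfg.state = M.cAcc) :
    M.payoff w c α β t cfg = α := by
  cases t <;> simp [payoff, h]

theorem payoff_of_rej (t : ℕ) {cfg : Config Q C} (h : cfg.state = M.cRej) :
    M.payoff w c α β t cfg = β := by
  cases t <;> simp [payoff, h, M.acc_ne_rej.symm]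

theorem payoff_le_succ (t : ℕ) (cfg : Config Q C) :
    M.payoff w c α β t cfg ≤ M.payoff w c α β (t + 1) cfg := by
  induction t generalizing cfg with
  | zero =>
    simp only [payoff]
    split_ifs <;> simp
  | succ t ih =>
    rw [payoff, payoff]
    split_ifs
    · rfl
    · rfl
    · gcongr
      exact ih _

theorem payoff_monotone (cfg : Config Q C) : Monotone fun t => M.payoff w c α β t cfg :=
  monotone_nat_of_le_succ fun t => M.payoff_le_succ w c α β t cfg

theorem payoff_succ_of_running (t : ℕ) (cfg : Config Q C)
    (h : cfg.state ≠ M.cAcc ∧ cfg.state ≠ M.cRej) :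
    M.payoff w c α β (t + 1) cfg =
      c + ∑' cfg', act cfg (M.δ ⟨cfg.state, h⟩ (tape w cfg.head)) cfg' *
        M.payoff w c α β t cfg' := by
  rw [payoff, if_neg h.1, if_neg h.2, step, dif_pos h]

theorem payoff_le_of_unitary (t : ℕ) (cfg : Config Q C)
    (h : cfg.state ≠ M.cAcc ∧ cfg.state ≠ M.cRej) {u : Matrix.unitaryGroup Q ℂ}
    {next : C × SignType} (hδ : M.δ ⟨cfg.state, h⟩ (tape w cfg.head) = .unitary u next) :
    M.payoff w c α β t cfg ≤
      c + M.payoff w c α β t (cfg.update next (cfg.reg.applyUnitary u)) := by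
  refine (M.payoff_le_succ w c α β t cfg).trans ?_
  rw [M.payoff_succ_of_running w c α β t cfg h, hδ, act, PMF.tsum_pure_mul]

/-- One step that performs a complete measurement. Results of probability zero are disregarded. -/
theorem payoff_le_of_observe (t : ℕ) (cfg : Config Q C)
    (h : cfg.state ≠ M.cAcc ∧ cfg.state ≠ M.cRej) {next : Q → C × SignType}
    (hδ : M.δ ⟨cfg.state, h⟩ (tape w cfg.head) = .observe next) (b : Q → ℝ≥0∞)
    (hb : ∀ q (ψ : Superposition Q), ψ.IsBasis q →
      M.payoff w c α β t (cfg.update (next q) ψ) ≤ b q) :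
    M.payoff w c α β t cfg ≤ c + ∑ q, cfg.reg.prob q * b q := by
  refine (M.payoff_le_succ w c α β t cfg).trans ?_
  rw [M.payoff_succ_of_running w c α β t cfg h, hδ, QAction.observe, act, PMF.tsum_map_mul,
    Superposition.tsum_measurePMF_mul]
  gcongr c + ?_
  refine Finset.sum_le_sum fun q _ => ?_
  by_cases hq : cfg.reg.1 q = 0
  · simp [Superposition.prob, hq]
  · gcongr
    exact hb q _ (cfg.reg.isBasis_collapse hq)

theorem payoff_ne_top (hc : c ≠ ∞) (hα : α ≠ ∞) (hβ : β ≠ ∞) (t : ℕ) :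
    ∃ B : ℝ≥0∞, B ≠ ∞ ∧ ∀ cfg, M.payoff w c α β t cfg ≤ B := by
  induction t with
  | zero =>
    refine ⟨α + β, by finiteness, fun cfg => ?_⟩
    rw [payoff]
    split_ifs <;> simp
  | succ t ih =>
    obtain ⟨B, hB, h⟩ := ih
    refine ⟨α + β + (c + B), by finiteness, fun cfg => ?_⟩
    rw [payoff]
    split_ifs
    · exact le_add_right le_self_add
    · exact le_add_right le_add_self
    · refine le_add_left (add_le_add_right ?_ c)
      calc ∑' cfg', M.step w cfg cfg' * M.payoff w c α β t cfg'
          ≤ ∑' cfg', M.step w cfg cfg' * B := ENNReal.tsum_le_tsum fun _ => by gcongr; exact h _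
        _ = B := by rw [ENNReal.tsum_mul_right, PMF.tsum_coe, one_mul]

/-- The probability that the classical state lies in `E` after `t` steps from `cfg`. -/
noncomputable def probFrom (t : ℕ) (E : Set C) (cfg : Config Q C) : ℝ≥0∞ :=
  (M.runFrom w t cfg).toOuterMeasure {cfg | cfg.state ∈ E}

theorem probFrom_zero (E : Set C) [DecidablePred (· ∈ E)] (cfg : Config Q C) :
    M.probFrom w 0 E cfg = if cfg.state ∈ E then 1 else 0 := by
  simp [probFrom, runFrom, PMF.toOuterMeasure_pure_apply]

theorem probFrom_succ (t : ℕ) (E : Set C) (cfg : Config Q C) :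
    M.probFrom w (t + 1) E cfg = ∑' cfg', M.step w cfg cfg' * M.probFrom w t E cfg' := by
  simp only [probFrom, runFrom, PMF.toOuterMeasure_bind_apply]

theorem probFrom_of_halted (t : ℕ) (E : Set C) [DecidablePred (· ∈ E)] (cfg : Config Q C)
    (h : ¬ (cfg.state ≠ M.cAcc ∧ cfg.state ≠ M.cRej)) :
    M.probFrom w t E cfg = if cfg.state ∈ E then 1 else 0 := by
  induction t with
  | zero => exact M.probFrom_zero w E cfg
  | succ t ih => rw [probFrom_succ, step, dif_neg h, PMF.tsum_pure_mul, ih]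

theorem probFrom_acc (t : ℕ) (cfg : Config Q C) :
    M.probFrom w t {M.cAcc} cfg = M.payoff w 0 1 0 t cfg := by
  classical
  induction t generalizing cfg with
  | zero => simp [probFrom_zero, payoff]
  | succ t ih =>
    by_cases h : cfg.state ≠ M.cAcc ∧ cfg.state ≠ M.cRej
    · rw [probFrom_succ, payoff, if_neg h.1, if_neg h.2, zero_add]
      simp only [ih]
    · rw [M.probFrom_of_halted w _ _ cfg h, payoff]
      simp only [Set.mem_singleton_iff]
      split_ifs with h1 h2
      · rfl
      · rfl
      · exact absurd ⟨h1, h2⟩ h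

theorem probFrom_rej (t : ℕ) (cfg : Config Q C) :
    M.probFrom w t {M.cRej} cfg = M.payoff w 0 0 1 t cfg := by
  classical
  have hne := M.acc_ne_rej
  induction t generalizing cfg with
  | zero =>
    simp only [probFrom_zero, payoff, Set.mem_singleton_iff]
    split_ifs with h1 h2 h2 <;> simp_all
  | succ t ih =>
    by_cases h : cfg.state ≠ M.cAcc ∧ cfg.state ≠ M.cRej
    · rw [probFrom_succ, payoff, if_neg h.1, if_neg h.2, zero_add]
      simp only [ih]
    · rw [M.probFrom_of_halted w _ _ cfg h, payoff]
      simp only [Set.mem_singleton_iff]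
      split_ifs with h1 h2 h2 <;> simp_all

theorem sum_probFrom_running (t : ℕ) (cfg : Config Q C) :
    ∑ s ∈ Finset.range t, M.probFrom w s {c | c ≠ M.cAcc ∧ c ≠ M.cRej} cfg ≤
      M.payoff w 1 0 0 t cfg := by
  classical
  induction t generalizing cfg with
  | zero => simp
  | succ t ih =>
    by_cases h : cfg.state ≠ M.cAcc ∧ cfg.state ≠ M.cRej
    · rw [payoff, if_neg h.1, if_neg h.2, Finset.sum_range_succ', add_comm]
      have h0 : M.probFrom w 0 {c | c ≠ M.cAcc ∧ c ≠ M.cRej} cfg = 1 := by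
        rw [probFrom_zero]
        exact if_pos h
      rw [h0]
      gcongr 1 + ?_
      simp only [probFrom_succ]
      rw [← Summable.tsum_finsetSum fun _ _ => ENNReal.summable]
      refine ENNReal.tsum_le_tsum fun cfg' => ?_
      rw [← Finset.mul_sum]
      gcongr
      exact ih cfg'
    · refine le_of_eq_of_le (Finset.sum_eq_zero fun s _ => ?_) zero_le
      rw [M.probFrom_of_halted w s _ cfg h]
      exact if_neg h

theorem expectedTime_le {B : ℝ≥0∞} (h : ∀ t, M.payoff w 1 0 0 t M.initial ≤ B) :
    M.expectedTime w ≤ B := by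
  rw [expectedTime, ENNReal.tsum_eq_iSup_nat]
  exact iSup_le fun t => (M.sum_probFrom_running w t M.initial).trans (h t)

theorem probAccept_le {B : ℝ≥0∞} (h : ∀ t, M.payoff w 0 1 0 t M.initial ≤ B) :
    M.probAccept w ≤ B :=
  iSup_le fun t => (M.probFrom_acc w t M.initial).trans_le (h t)

theorem probReject_le {B : ℝ≥0∞} (h : ∀ t, M.payoff w 0 0 1 t M.initial ≤ B) :
    M.probReject w ≤ B :=
  iSup_le fun t => (M.probFrom_rej w t M.initial).trans_le (h t)

/-- A machine whose expected running time is finite halts almost surely. -/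
theorem probAccept_add_probReject (h : M.expectedTime w ≠ ∞) :
    M.probAccept w + M.probReject w = 1 := by
  classical
  have hsum : ∀ t, M.probAt w t {M.cAcc} + M.probAt w t {M.cRej} +
      M.probAt w t {c | c ≠ M.cAcc ∧ c ≠ M.cRej} = 1 := by
    intro t
    have hne := M.acc_ne_rej
    simp only [probAt, PMF.toOuterMeasure_apply]
    rw [← ENNReal.tsum_add, ← ENNReal.tsum_add, ← PMF.tsum_coe (M.runFrom w t M.initial)]
    refine tsum_congr fun cfg => ?_
    simp only [Set.indicator_apply, Set.mem_ofPred_eq, Set.mem_singleton_iff]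
    by_cases h1 : cfg.state = M.cAcc
    · simp [h1, hne]
    · by_cases h2 : cfg.state = M.cRej <;> simp [h1, h2, hne.symm]
  have hacc : Monotone fun t => M.probAt w t {M.cAcc} := by
    intro s t hst
    have := M.payoff_monotone w 0 1 0 M.initial hst
    simp only [← probFrom_acc] at this
    exact this
  have hrej : Monotone fun t => M.probAt w t {M.cRej} := by
    intro s t hst
    have := M.payoff_monotone w 0 0 1 M.initial hst
    simp only [← probFrom_rej] at this
    exact this
  have hlim := ENNReal.tendsto_atTop_zero_of_tsum_ne_top h
  have h1 := (tendsto_atTop_iSup hacc).add (tendsto_atTop_iSup hrej)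
  have h2 := h1.add hlim
  simp only [hsum, add_zero] at h2
  exact (tendsto_nhds_unique h2 tendsto_const_nhds)

end TwoQCFA

/-! ### The machine that repeats one-sided tests -/

/-- The classical states of the machine that repeats one-sided tests: `start i j` begins the round
of test `i` with the register in the basis state `j`, `forward i x` sweeps to the right while `x`
tracks the prefix read so far, `check i x` performs the measurement of the test, and
`backward i b j`, `flip i b` sweep to the left tossing a coin at every cell, where `b` says
whether all the tosses so far have been successful. -/
inductive SweepState (d N : ℕ) (X : Type) : Type
  | start (i : ZMod N) (j : Fin d)
  | forward (i : ZMod N) (x : X)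
  | check (i : ZMod N) (x : X)
  | backward (i : ZMod N) (b : Bool) (j : Fin d)
  | flip (i : ZMod N) (b : Bool)
  | accept
  | reject

instance SweepState.finite (d N : ℕ) [NeZero N] (X : Type) [Finite X] :
    Finite (SweepState d N X) := by
  let f : (ZMod N × Fin d) ⊕ (ZMod N × X) ⊕ (ZMod N × X) ⊕ (ZMod N × Bool × Fin d) ⊕
      (ZMod N × Bool) ⊕ Bool → SweepState d N X
    | .inl (i, j) => .start i j
    | .inr (.inl (i, x)) => .forward i x
    | .inr (.inr (.inl (i, x))) => .check i x
    | .inr (.inr (.inr (.inl (i, b, j)))) => .backward i b j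
    | .inr (.inr (.inr (.inr (.inl (i, b))))) => .flip i b
    | .inr (.inr (.inr (.inr (.inr b)))) => if b then .accept else .reject
  refine Finite.of_surjective f fun s => ?_
  cases s with
  | start i j => exact ⟨.inl (i, j), rfl⟩
  | forward i x => exact ⟨.inr (.inl (i, x)), rfl⟩
  | check i x => exact ⟨.inr (.inr (.inl (i, x))), rfl⟩
  | backward i b j => exact ⟨.inr (.inr (.inr (.inl (i, b, j)))), rfl⟩
  | flip i b => exact ⟨.inr (.inr (.inr (.inr (.inl (i, b))))), rfl⟩
  | accept => exact ⟨.inr (.inr (.inr (.inr (.inr true)))), rfl⟩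
  | reject => exact ⟨.inr (.inr (.inr (.inr (.inr false)))), rfl⟩

/-- The pairs of a state and a letter that occur while a finite automaton reads a word, the last one
first: a product over this list is the operator that applies one factor for each letter, in the
order of the word. -/
def scanned {X A : Type*} (track : X → A → X) : X → List A → List (X × A)
  | _, [] => []
  | x, a :: l => scanned track (track x a) l ++ [(x, a)]

theorem length_scanned {X A : Type*} (track : X → A → X) (x : X) (l : List A) :
    (scanned track x l).length = l.length := by
  induction l generalizing x with
  | nil => rfl
  | cons a l ih => simp [scanned, ih]

/-- A finite family of one-sided tests on words, indexed by `ZMod N`. Test `i` prepares the register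
in the state `prep i |q₀⟩`, reads the word from the left applying at each letter `a` the unitary
`gate i x a`, where `x` is the state of a finite automaton that reads the word as well, undoes the
preparation, and fails unless the register is then observed in `|q₀⟩` and the automaton has ended
in an accepting state. The unitary `coin` provides the random bits of the machine, and `reset j`
takes `|j⟩` to `|q₀⟩` up to a phase. -/
structure TestFamily (d N : ℕ) (X : Type) (A : Type*) where
  q₀ : Fin d
  x₀ : X
  track : X → A → X
  good : X → Prop
  gate : ZMod N → X → A → algebraicUnitaryGroup d
  prep : ZMod N → algebraicUnitaryGroup d
  coin : algebraicUnitaryGroup d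
  reset : Fin d → algebraicUnitaryGroup d
  reset_apply : ∀ j r, r ≠ q₀ → ((reset j).1 : Matrix (Fin d) (Fin d) ℂ) r j = 0

namespace TestFamily

variable {d N : ℕ} {X : Type} {A : Type*} (P : TestFamily d N X A)

open Classical in
/-- The transition function of the machine that repeats the tests of `P`. -/
noncomputable def action :
    SweepState d N X → TapeSymbol A → QAction (Fin d) (SweepState d N X)
  | .start i j, .rightEnd => .unitary (P.prep i * P.reset j).1 (.forward i P.x₀, 0)
  | .start i j, _ => .unitary (P.prep i * P.reset j).1 (.forward i P.x₀, 1)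
  | .forward i x, .leftEnd => .unitary (1 : algebraicUnitaryGroup d).1 (.forward i x, 0)
  | .forward i x, .letter a => .unitary (P.gate i x a).1 (.forward i (P.track x a), 1)
  | .forward i x, .rightEnd => .unitary (P.prep i)⁻¹.1 (.check i x, 0)
  | .check i x, _ => .observe fun j => 
      if P.good x ∧ j = P.q₀ then (.backward i true j, 0) else (.reject, 0)
  | .backward i b j, _ => .unitary (P.coin * P.reset j).1 (.flip i b, 0)
  | .flip i b, .leftEnd => .observe fun j => 
      if b ∧ j = P.q₀ then (.accept, 0) else (.start (i + 1) j, 0)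
  | .flip i b, _ => .observe fun j => (.backward i (b && decide (j = P.q₀)) j, -1)
  | .accept, _ => .unitary (1 : algebraicUnitaryGroup d).1 (.accept, 0)
  | .reject, _ => .unitary (1 : algebraicUnitaryGroup d).1 (.reject, 0)

/-- The machine that runs the tests of `P` cyclically: a failed test rejects, and after each test
that is passed the machine accepts with a small probability. -/
noncomputable def machine : TwoQCFA (Fin d) (SweepState d N X) A where
  qStart := P.q₀
  cStart := .start 0 P.q₀
  cAcc := .accept
  cRej := .reject
  acc_ne_rej := by simp
  δ s := P.action s.1
  leftEnd_move := by
    rintro ⟨s, hs⟩ o ho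
    cases s
    case check =>
      rw [action, QAction.effects_observe] at ho
      obtain ⟨j, rfl⟩ := ho
      dsimp only
      split_ifs <;> dsimp only <;> decide
    case flip =>
      rw [action, QAction.effects_observe] at ho
      obtain ⟨j, rfl⟩ := ho
      dsimp only
      split_ifs <;> dsimp only <;> decide
    all_goals
      simp only [action, QAction.effects, Set.mem_singleton_iff] at ho
      rw [ho]
      dsimp only
      decide
  rightEnd_move := by
    rintro ⟨s, hs⟩ o ho
    cases s
    case check =>
      rw [action, QAction.effects_observe] at ho
      obtain ⟨j, rfl⟩ := ho
      dsimp only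
      split_ifs <;> dsimp only <;> decide
    case flip =>
      rw [action, QAction.effects_observe] at ho
      · obtain ⟨j, rfl⟩ := ho
        dsimp only
        decide
      · simp
    all_goals
      rw [action, QAction.effects] at ho
      rw [ho]
      dsimp only
      decide

theorem amplitudes_machine : P.machine.amplitudes ⊆ algebraicNumbers := by
  rintro _ ⟨⟨s, hs⟩, γ, u, next, h, i, j, rfl⟩
  suffices hu : u ∈ algebraicUnitaryGroup d from hu i j
  change P.action s γ = _ at h
  cases s <;> cases γ <;> simp only [action, QAction.observe, QAction.unitary.injEq,
    reduceCtorEq] at h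
  all_goals
    obtain ⟨rfl, -⟩ := h
    exact Subtype.property _

/-- The unitary that the gates of test `i` apply while the word `l` is read from tracking
state `x`. -/
def run (i : ZMod N) (x : X) (l : List A) : algebraicUnitaryGroup d :=
  ((scanned P.track x l).map fun p => P.gate i p.1 p.2).prod

theorem run_cons (i : ZMod N) (x : X) (a : A) (l : List A) :
    P.run i x (a :: l) = P.run i (P.track x a) l * P.gate i x a := by
  simp [run, scanned]

/-- The unitary whose `q₀`-th diagonal entry is the amplitude with which `w` passes test `i`. -/
def testUnitary (i : ZMod N) (w : List A) : algebraicUnitaryGroup d :=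
  (P.prep i)⁻¹ * P.run i P.x₀ w * P.prep i

/-- The probability that the measurement of test `i` has the result `q₀`. -/
noncomputable def passProb (i : ZMod N) (w : List A) : ℝ≥0∞ :=
  ENNReal.ofReal (‖((P.testUnitary i w).1 : Matrix (Fin d) (Fin d) ℂ) P.q₀ P.q₀‖ ^ 2)

/-- The probability of success in one toss of the coin. -/
noncomputable def coinProb : ℝ≥0∞ :=
  ENNReal.ofReal (‖(P.coin.1 : Matrix (Fin d) (Fin d) ℂ) P.q₀ P.q₀‖ ^ 2)

theorem isBasis_reset {ψ : Superposition (Fin d)} {j : Fin d} (h : ψ.IsBasis j) :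
    (ψ.applyUnitary (P.reset j).1).IsBasis P.q₀ := by
  intro r hr
  rw [h.applyUnitary_apply, P.reset_apply j r hr, zero_mul]

theorem prob_applyUnitary {ψ : Superposition (Fin d)} {q : Fin d} (h : ψ.IsBasis q)
    (u : Matrix.unitaryGroup (Fin d) ℂ) :
    (ψ.applyUnitary u).prob q =
      ENNReal.ofReal (‖(u : Matrix (Fin d) (Fin d) ℂ) q q‖ ^ 2) := by
  rw [Superposition.prob, h.applyUnitary_apply, norm_mul, h.norm_apply, mul_one]

theorem _root_.TwoQCFA.tape_eq_letter (l₁ : List A) (a : A) (l₂ : List A) :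
    TwoQCFA.tape (l₁ ++ a :: l₂) (l₁.length + 1) = .letter a := by
  simp [TwoQCFA.tape]

theorem _root_.TwoQCFA.tape_eq_rightEnd (w : List A) :
    TwoQCFA.tape w (w.length + 1) = .rightEnd := by
  simp [TwoQCFA.tape]

theorem _root_.TwoQCFA.tape_ne_leftEnd (w : List A) (i : ℕ) :
    TwoQCFA.tape w (i + 1) ≠ .leftEnd := by
  simp only [TwoQCFA.tape, Nat.add_eq_zero_iff, one_ne_zero, and_false, if_false]
  split <;> simp

theorem _root_.TwoQCFA.moveHead_zero (i : ℕ) : TwoQCFA.moveHead i 0 = i := rfl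

theorem _root_.TwoQCFA.moveHead_succ_neg_one (i : ℕ) : TwoQCFA.moveHead (i + 1) (-1) = i := rfl

variable (w : List A) (c α β : ℝ≥0∞) (t : ℕ)

theorem payoff_forward (i : ZMod N) (x : X) (l₁ l₂ : List A) (hw : l₁ ++ l₂ = w)
    (ψ : Superposition (Fin d)) :
    P.machine.payoff w c α β t ⟨.forward i x, l₁.length + 1, ψ⟩ ≤
      l₂.length * c + P.machine.payoff w c α β t
        ⟨.forward i (l₂.foldl P.track x), w.length + 1, ψ.applyUnitary (P.run i x l₂).1⟩ := by
  induction l₂ generalizing l₁ x ψ with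
  | nil =>
    rw [List.append_nil] at hw
    subst hw
    simp [run, scanned, Superposition.applyUnitary_one]
  | cons a l₂ ih =>
    refine (P.machine.payoff_le_of_unitary w c α β t _
      (by simp [machine]) (u := (P.gate i x a).1)
      (next := (.forward i (P.track x a), 1)) ?_).trans ?_
    · subst hw
      simp only [TwoQCFA.tape_eq_letter]
      rfl
    · have h := ih (P.track x a) (l₁ ++ [a]) (by simpa using hw) (ψ.applyUnitary (P.gate i x a).1)
      rw [← Superposition.applyUnitary_mul] at h
      have e : TwoQCFA.moveHead (l₁.length + 1) 1 = (l₁ ++ [a]).length + 1 := by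
        rw [List.length_append]; rfl
      simp only [TwoQCFA.Config.update, e]
      refine (add_le_add_right h c).trans ?_
      rw [← add_assoc, List.length_cons, Nat.cast_succ, add_mul, one_mul, add_comm c, run_cons]
      rfl

theorem action_flip_of_ne (i : ZMod N) (b : Bool) {γ : TapeSymbol A} (h : γ ≠ .leftEnd) :
    P.action (.flip i b) γ = .observe fun j => (.backward i (b && decide (j = P.q₀)) j, -1) := by
  cases γ
  · exact absurd rfl h
  · rfl
  · rfl

theorem coinProb_le_one : P.coinProb ≤ 1 := by
  rw [coinProb, ← prob_applyUnitary (Superposition.isBasis_basis P.q₀)]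
  exact Superposition.prob_le_one _ _

theorem payoff_backward_le_flip (i : ZMod N) (b : Bool) (h : ℕ) (j : Fin d)
    (ψ : Superposition (Fin d)) :
    P.machine.payoff w c α β t ⟨.backward i b j, h, ψ⟩ ≤
      c + P.machine.payoff w c α β t ⟨.flip i b, h, ψ.applyUnitary (P.coin * P.reset j).1⟩ :=
  P.machine.payoff_le_of_unitary w c α β t _
      (by simp [machine]) (u := (P.coin * P.reset j).1) (next := (.flip i b, 0)) rfl

/-- The sweep to the left after an unsuccessful toss, where `s` bounds the payoff from the next
round on. -/
theorem payoff_backward_false (i : ZMod N) (s : ℝ≥0∞)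
    (hs : ∀ j ψ, ψ.IsBasis j → P.machine.payoff w c α β t ⟨.start (i + 1) j, 0, ψ⟩ ≤ s)
    (h : ℕ) (j : Fin d) (ψ : Superposition (Fin d)) :
    P.machine.payoff w c α β t ⟨.backward i false j, h, ψ⟩ ≤ 2 * (h + 1) * c + s := by
  induction h generalizing j ψ with
  | zero =>
    refine (P.payoff_backward_le_flip w c α β t i false 0 j ψ).trans ?_
    have := P.machine.payoff_le_of_observe w c α β t
      ⟨.flip i false, 0, ψ.applyUnitary (P.coin * P.reset j).1⟩ (by simp [machine]) rfl
      (fun _ => s) fun q φ hφ => by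
        simpa [TwoQCFA.Config.update, TwoQCFA.moveHead_zero] using hs q φ hφ
    refine (add_le_add_right this c).trans ?_
    rw [← Finset.sum_mul, Superposition.sum_prob, ← add_assoc, Nat.cast_zero, zero_add, mul_one,
      one_mul, two_mul]
  | succ h ih =>
    refine (P.payoff_backward_le_flip w c α β t i false (h + 1) j ψ).trans ?_
    have := P.machine.payoff_le_of_observe w c α β t
      ⟨.flip i false, h + 1, ψ.applyUnitary (P.coin * P.reset j).1⟩ (by simp [machine])
      (P.action_flip_of_ne i false (TwoQCFA.tape_ne_leftEnd w h))
      (fun _ => 2 * (h + 1) * c + s) fun q φ _ => ih q φ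
    refine (add_le_add_right this c).trans (le_of_eq ?_)
    rw [← Finset.sum_mul, Superposition.sum_prob]
    push_cast
    ring

theorem _root_.ENNReal.convex_comb_convex_comb {p r : ℝ≥0∞} (hp : p ≤ 1) (hr : r ≤ 1)
    (x y : ℝ≥0∞) :
    p * (r * x + (1 - r) * y) + (1 - p) * y = p * r * x + (1 - p * r) * y := by
  have hpr : p * r ≤ 1 := mul_le_one' hp hr
  have h : p * (1 - r) + (1 - p) = 1 - p * r := by
    refine ENNReal.eq_sub_of_add_eq (hpr.trans_lt ENNReal.one_lt_top).ne ?_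
    calc p * (1 - r) + (1 - p) + p * r = p * (1 - r + r) + (1 - p) := by ring
      _ = 1 := by rw [tsub_add_cancel_of_le hr, mul_one, add_tsub_cancel_of_le hp]
  rw [← h]
  ring

theorem _root_.ENNReal.convex_comb_add {p : ℝ≥0∞} (hp : p ≤ 1) (k x y : ℝ≥0∞) :
    p * (k + x) + (1 - p) * (k + y) = k + (p * x + (1 - p) * y) := by
  calc p * (k + x) + (1 - p) * (k + y) = (p + (1 - p)) * k + (p * x + (1 - p) * y) := by ring
    _ = _ := by rw [add_tsub_cancel_of_le hp, one_mul]

/-- The sweep to the left while all tosses have been successful: there are `h + 1` tosses to go. -/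
theorem payoff_backward_true (i : ZMod N) (s : ℝ≥0∞)
    (hs : ∀ j ψ, ψ.IsBasis j → P.machine.payoff w c α β t ⟨.start (i + 1) j, 0, ψ⟩ ≤ s)
    (h : ℕ) (j : Fin d) (ψ : Superposition (Fin d)) (hψ : ψ.IsBasis j) :
    P.machine.payoff w c α β t ⟨.backward i true j, h, ψ⟩ ≤
      2 * (h + 1) * c + (P.coinProb ^ (h + 1) * α + (1 - P.coinProb ^ (h + 1)) * s) := by
  have hprob : (ψ.applyUnitary (P.coin * P.reset j).1).prob P.q₀ = P.coinProb := by
    rw [Subgroup.coe_mul, Superposition.applyUnitary_mul, prob_applyUnitary (P.isBasis_reset hψ),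
      coinProb]
  have hp := P.coinProb_le_one
  induction h generalizing j ψ with
  | zero =>
    refine (P.payoff_backward_le_flip w c α β t i true 0 j ψ).trans ?_
    have := P.machine.payoff_le_of_observe w c α β t
      ⟨.flip i true, 0, ψ.applyUnitary (P.coin * P.reset j).1⟩ (by simp [machine]) rfl
      (fun q => if q = P.q₀ then α else s) fun q φ hφ => by
        by_cases hq : q = P.q₀
        · rw [if_pos hq]
          refine (P.machine.payoff_of_acc w c α β t ?_).le
          simp [TwoQCFA.Config.update, hq, machine]
        · rw [if_neg hq]
          simpa [TwoQCFA.Config.update, TwoQCFA.moveHead_zero, hq] using hs q φ hφ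
    refine (add_le_add_right this c).trans (le_of_eq ?_)
    rw [Superposition.sum_prob_mul_ite, hprob, Nat.cast_zero, zero_add, zero_add, pow_one]
    ring
  | succ h ih =>
    refine (P.payoff_backward_le_flip w c α β t i true (h + 1) j ψ).trans ?_
    have := P.machine.payoff_le_of_observe w c α β t
      ⟨.flip i true, h + 1, ψ.applyUnitary (P.coin * P.reset j).1⟩ (by simp [machine])
      (P.action_flip_of_ne i true (TwoQCFA.tape_ne_leftEnd w h))
      (fun q => if q = P.q₀ then
          2 * (h + 1) * c + (P.coinProb ^ (h + 1) * α + (1 - P.coinProb ^ (h + 1)) * s)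
        else 2 * (h + 1) * c + s) fun q φ hφ => by
        by_cases hq : q = P.q₀
        · rw [if_pos hq]
          have := ih q φ hφ (by
            rw [Subgroup.coe_mul, Superposition.applyUnitary_mul,
              prob_applyUnitary (P.isBasis_reset hφ), coinProb])
          simpa [TwoQCFA.Config.update, TwoQCFA.moveHead_succ_neg_one, hq] using this
        · rw [if_neg hq]
          have := P.payoff_backward_false w c α β t i s hs h q φ
          simpa [TwoQCFA.Config.update, TwoQCFA.moveHead_succ_neg_one, hq] using this
    refine (add_le_add_right this c).trans (le_of_eq ?_)
    rw [Superposition.sum_prob_mul_ite, hprob, ENNReal.convex_comb_add hp,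
      ENNReal.convex_comb_convex_comb hp (pow_le_one' hp _), ← pow_succ' P.coinProb (h + 1)]
    push_cast
    ring

open scoped Classical in
/-- The probability that `w` passes test `i`. -/
noncomputable def pass (i : ZMod N) : ℝ≥0∞ :=
  if P.good (w.foldl P.track P.x₀) then P.passProb i w else 0

theorem passProb_le_one (i : ZMod N) : P.passProb i w ≤ 1 := by
  rw [passProb, ← prob_applyUnitary (Superposition.isBasis_basis P.q₀)]
  exact Superposition.prob_le_one _ _

theorem pass_le_one (i : ZMod N) : P.pass w i ≤ 1 := by
  rw [pass]
  split_ifs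
  · exact P.passProb_le_one w i
  · exact zero_le

open scoped Classical in
/-- One round of the machine, where `s` bounds the payoff from the next round on. -/
theorem payoff_start (i : ZMod N) (s : ℝ≥0∞)
    (hs : ∀ j ψ, ψ.IsBasis j → P.machine.payoff w c α β t ⟨.start (i + 1) j, 0, ψ⟩ ≤ s)
    (j : Fin d) (ψ : Superposition (Fin d)) (hψ : ψ.IsBasis j) :
    P.machine.payoff w c α β t ⟨.start i j, 0, ψ⟩ ≤
      (3 * w.length + 7) * c + (P.pass w i * (P.coinProb ^ (w.length + 2) * α +
        (1 - P.coinProb ^ (w.length + 2)) * s) + (1 - P.pass w i) * β) := by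
  set ψ₁ := ψ.applyUnitary (P.prep i * P.reset j).1 with hψ₁
  set ψ₂ := ψ₁.applyUnitary (P.run i P.x₀ w).1 with hψ₂
  set ψ₃ := ψ₂.applyUnitary (P.prep i)⁻¹.1 with hψ₃
  set x := w.foldl P.track P.x₀ with hx
  set V := P.coinProb ^ (w.length + 2) * α + (1 - P.coinProb ^ (w.length + 2)) * s with hV
  have e₁ : P.machine.payoff w c α β t ⟨.start i j, 0, ψ⟩ ≤
      c + P.machine.payoff w c α β t ⟨.forward i P.x₀, 1, ψ₁⟩ :=
    P.machine.payoff_le_of_unitary w c α β t _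
      (by simp [machine]) (u := (P.prep i * P.reset j).1) (next := (.forward i P.x₀, 1)) rfl
  have e₂ : P.machine.payoff w c α β t ⟨.forward i P.x₀, 1, ψ₁⟩ ≤
      w.length * c + P.machine.payoff w c α β t ⟨.forward i x, w.length + 1, ψ₂⟩ :=
    P.payoff_forward w c α β t i P.x₀ [] w rfl ψ₁
  have e₃ : P.machine.payoff w c α β t ⟨.forward i x, w.length + 1, ψ₂⟩ ≤
      c + P.machine.payoff w c α β t ⟨.check i x, w.length + 1, ψ₃⟩ :=
    P.machine.payoff_le_of_unitary w c α β t _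
      (by simp [machine]) (u := (P.prep i)⁻¹.1) (next := (.check i x, 0)) (by
        simp only [TwoQCFA.tape_eq_rightEnd]
        rfl)
  have hprob : ψ₃.prob P.q₀ = P.passProb i w := by
    rw [hψ₃, hψ₂, hψ₁, Subgroup.coe_mul, Superposition.applyUnitary_mul,
      ← Superposition.applyUnitary_mul, ← Superposition.applyUnitary_mul,
      prob_applyUnitary (P.isBasis_reset hψ), passProb, testUnitary]
    rfl
  have e₄ : P.machine.payoff w c α β t ⟨.check i x, w.length + 1, ψ₃⟩ ≤
      c + (2 * (w.length + 2) * c + (P.pass w i * V + (1 - P.pass w i) * β)) := by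
    refine (P.machine.payoff_le_of_observe w c α β t _ (by simp [machine]) rfl
      (fun q => if P.good x ∧ q = P.q₀ then 2 * (w.length + 2) * c + V else
        2 * (w.length + 2) * c + β) fun q φ hφ => ?_).trans ?_
    · by_cases hq : P.good x ∧ q = P.q₀
      · rw [if_pos hq, if_pos hq]
        have := P.payoff_backward_true w c α β t i s hs (w.length + 1) q φ hφ
        refine this.trans (le_of_eq ?_)
        push_cast
        ring
      · rw [if_neg hq, if_neg hq]
        exact (P.machine.payoff_of_rej w c α β t rfl).trans_le le_add_self
    · gcongr c + ?_
      by_cases hg : P.good x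
      · simp only [hg, true_and]
        rw [Superposition.sum_prob_mul_ite, hprob, pass, if_pos hg,
          ENNReal.convex_comb_add (P.passProb_le_one w i)]
      · simp only [hg, false_and, if_false]
        rw [← Finset.sum_mul, Superposition.sum_prob, pass, if_neg hg]
        simp
  refine e₁.trans ?_
  calc _ ≤ c + (w.length * c + (c + (c + (2 * (w.length + 2) * c +
        (P.pass w i * V + (1 - P.pass w i) * β))))) := by
        gcongr
        exact e₂.trans (add_le_add_right (e₃.trans (add_le_add_right e₄ _)) _)
    _ = _ := by ring

/-- The largest payoff at the beginning of a round of test `i`. -/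
noncomputable def roundPayoff (i : ZMod N) : ℝ≥0∞ :=
  ⨆ (j : Fin d) (ψ : Superposition (Fin d)) (_ : ψ.IsBasis j),
    P.machine.payoff w c α β t ⟨.start i j, 0, ψ⟩

theorem roundPayoff_le (i : ZMod N) :
    P.roundPayoff w c α β t i ≤ (3 * w.length + 7) * c +
      (P.pass w i * (P.coinProb ^ (w.length + 2) * α +
        (1 - P.coinProb ^ (w.length + 2)) * P.roundPayoff w c α β t (i + 1)) +
          (1 - P.pass w i) * β) :=
  iSup_le fun j => iSup_le fun ψ => iSup_le fun hψ =>
    P.payoff_start w c α β t i _ (fun j ψ hψ => by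
      exact le_iSup_of_le j (le_iSup_of_le ψ (le_iSup_of_le hψ le_rfl))) j ψ hψ

theorem payoff_initial_le :
    P.machine.payoff w c α β t P.machine.initial ≤ P.roundPayoff w c α β t 0 :=
  le_iSup_of_le P.q₀ (le_iSup_of_le (Superposition.basis P.q₀)
    (le_iSup_of_le (Superposition.isBasis_basis P.q₀) le_rfl))

theorem iSup_roundPayoff_ne_top (hc : c ≠ ∞) (hα : α ≠ ∞) (hβ : β ≠ ∞) :
    ⨆ i, P.roundPayoff w c α β t i ≠ ∞ := by
  obtain ⟨B, hB, h⟩ := P.machine.payoff_ne_top w c α β hc hα hβ t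
  refine ne_top_of_le_ne_top hB ?_
  exact iSup_le fun i => iSup_le fun j => iSup_le fun ψ => iSup_le fun hψ => h _

theorem _root_.ENNReal.le_div_of_le_add_one_sub_mul {s k p : ℝ≥0∞} (hs : s ≠ ∞) (hp : p ≤ 1)
    (hp₀ : p ≠ 0) (h : s ≤ k + (1 - p) * s) : s ≤ k / p := by
  have h1 : s = p * s + (1 - p) * s := by
    rw [← add_mul, add_tsub_cancel_of_le hp, one_mul]
  have hfin : (1 - p) * s ≠ ∞ := ENNReal.mul_ne_top (by simp) hs
  have h2 : p * s ≤ k := by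
    refine (ENNReal.add_le_add_iff_right hfin).1 ?_
    rwa [← h1]
  rw [ENNReal.le_div_iff_mul_le (Or.inl hp₀) (Or.inl (hp.trans_lt ENNReal.one_lt_top).ne), mul_comm]
  exact h2

theorem expectedTime_machine_le (hcoin : P.coinProb ≠ 0) :
    P.machine.expectedTime w ≤ (3 * w.length + 7) / P.coinProb ^ (w.length + 2) := by
  refine P.machine.expectedTime_le w fun t => (P.payoff_initial_le w 1 0 0 t).trans ?_
  refine (le_iSup (P.roundPayoff w 1 0 0 t) 0).trans ?_
  refine ENNReal.le_div_of_le_add_one_sub_mul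
    (P.iSup_roundPayoff_ne_top w 1 0 0 t (by simp) (by simp) (by simp))
    (pow_le_one' P.coinProb_le_one _) (pow_ne_zero _ hcoin) (iSup_le fun i => ?_)
  refine (P.roundPayoff_le w 1 0 0 t i).trans ?_
  rw [mul_one, mul_zero, mul_zero, zero_add, add_zero]
  refine add_le_add_right ((mul_le_of_le_one_left' (P.pass_le_one w i)).trans ?_) _
  gcongr
  exact le_iSup (P.roundPayoff w 1 0 0 t) (i + 1)

theorem probReject_machine_eq_zero (hcoin : P.coinProb ≠ 0) (hw : ∀ i, P.pass w i = 1) :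
    P.machine.probReject w = 0 := by
  refine le_antisymm ?_ zero_le
  refine P.machine.probReject_le w fun t => (P.payoff_initial_le w 0 0 1 t).trans ?_
  refine (le_iSup (P.roundPayoff w 0 0 1 t) 0).trans ?_
  refine (ENNReal.le_div_of_le_add_one_sub_mul (k := 0)
    (P.iSup_roundPayoff_ne_top w 0 0 1 t (by simp) (by simp) (by simp))
    (pow_le_one' P.coinProb_le_one (w.length + 2)) (pow_ne_zero _ hcoin)
    (iSup_le fun i => ?_)).trans (by simp)
  refine (P.roundPayoff_le w 0 0 1 t i).trans ?_
  rw [hw i, mul_zero, mul_zero, zero_add, zero_add, one_mul, tsub_self, zero_mul, add_zero,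
    zero_add]
  gcongr
  exact le_iSup (P.roundPayoff w 0 0 1 t) (i + 1)

theorem probAccept_machine_eq_zero (hw : ¬ P.good (w.foldl P.track P.x₀)) :
    P.machine.probAccept w = 0 := by
  refine le_antisymm ?_ zero_le
  refine P.machine.probAccept_le w fun t => (P.payoff_initial_le w 0 1 0 t).trans ?_
  refine (P.roundPayoff_le w 0 1 0 t 0).trans ?_
  rw [pass, if_neg hw]
  simp

/-- If some test is failed with probability at least `r`, then it is reached within `N` rounds, and
so a cycle of `N` rounds accepts with probability at most `N` times that of a successful run of
coin tosses, and otherwise is repeated with probability at most `1 - r`. -/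
theorem probAccept_machine_le [NeZero N] (i₀ : ZMod N) (r : ℝ≥0∞) (hr₀ : r ≠ 0) (hr₁ : r ≤ 1)
    (hr : P.pass w i₀ ≤ 1 - r) :
    P.machine.probAccept w ≤ N * P.coinProb ^ (w.length + 2) / r := by
  refine P.machine.probAccept_le w fun t => (P.payoff_initial_le w 0 1 0 t).trans ?_
  refine (le_iSup (P.roundPayoff w 0 1 0 t) 0).trans ?_
  set a := P.coinProb ^ (w.length + 2) with ha
  set S := ⨆ i, P.roundPayoff w 0 1 0 t i with hS
  have hstep : ∀ i, P.roundPayoff w 0 1 0 t i ≤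
      P.pass w i * (a + P.roundPayoff w 0 1 0 t (i + 1)) := by
    intro i
    refine (P.roundPayoff_le w 0 1 0 t i).trans ?_
    rw [mul_zero, mul_zero, zero_add, add_zero, mul_one]
    gcongr
    exact mul_le_of_le_one_left' tsub_le_self
  refine ENNReal.le_div_of_le_add_one_sub_mul
    (P.iSup_roundPayoff_ne_top w 0 1 0 t (by simp) (by simp) (by simp)) hr₁ hr₀
    (iSup_le fun i => ?_)
  have hiter : ∀ m : ℕ, P.roundPayoff w 0 1 0 t (i₀ - m) ≤ (m + 1 : ℕ) * a + (1 - r) * S := by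
    intro m
    induction m with
    | zero =>
      rw [Nat.cast_zero, sub_zero, zero_add, Nat.cast_one, one_mul]
      refine (hstep i₀).trans ?_
      rw [mul_add]
      refine add_le_add (mul_le_of_le_one_left' (P.pass_le_one w i₀)) ?_
      gcongr
      exact le_iSup (P.roundPayoff w 0 1 0 t) (i₀ + 1)
    | succ m ih =>
      refine (hstep _).trans ((mul_le_of_le_one_left' (P.pass_le_one w _)).trans ?_)
      have e : i₀ - (m + 1 : ℕ) + 1 = i₀ - m := by push_cast; ring
      rw [e]
      refine (add_le_add_right ih a).trans (le_of_eq ?_)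
      push_cast
      ring
  have h := hiter (i₀ - i).val
  rw [ZMod.natCast_val, ZMod.cast_id, sub_sub_cancel] at h
  refine h.trans ?_
  gcongr
  exact ZMod.val_lt _

end TestFamily

/-! ### Algebraic unitary matrices and tests of centrality -/

/-- A unit vector with rational coordinates is a column of a unitary matrix with algebraic entries:
the reflection that exchanges it with a basis vector. -/
theorem exists_algebraicUnitary_col {d : ℕ} (q : Fin d) (v : Fin d → ℚ) (hv : v ⬝ᵥ v = 1) :
    ∃ V : algebraicUnitaryGroup d, ∀ i, (V.1 : Matrix (Fin d) (Fin d) ℂ) i q = v i := by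
  by_cases hq : v q = 1
  · refine ⟨1, fun i => ?_⟩
    have h0 : ∑ j ∈ Finset.univ.erase q, v j * v j = 0 := by
      have := Finset.add_sum_erase Finset.univ (fun j => v j * v j) (Finset.mem_univ q)
      rw [dotProduct] at hv
      rw [hv, hq] at this
      linarith
    rw [Finset.sum_eq_zero_iff_of_nonneg fun j _ => mul_self_nonneg _] at h0
    change (1 : Matrix (Fin d) (Fin d) ℂ) i q = v i
    by_cases hi : i = q
    · subst hi
      simp [hq]
    · have := h0 i (by simp [hi])
      rw [Matrix.one_apply_ne hi, mul_self_eq_zero.1 this, Rat.cast_zero]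
  · set u : Fin d → ℚ := Pi.single q 1 - v with hu
    set H : Matrix (Fin d) (Fin d) ℚ := 1 - (1 - v q)⁻¹ • Matrix.vecMulVec u u with hH
    have h1 : 1 - v q ≠ 0 := sub_ne_zero.2 (Ne.symm hq)
    have huu : u ⬝ᵥ u = 2 * (1 - v q) := by
      rw [hu, sub_dotProduct, dotProduct_sub, dotProduct_sub, hv]
      simp
      ring
    have hHt : Hᵀ = H := by
      rw [hH, Matrix.transpose_sub, Matrix.transpose_smul, Matrix.transpose_vecMulVec,
        Matrix.transpose_one]
    have hHH : H * H = 1 := by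
      have hsq : Matrix.vecMulVec u u * Matrix.vecMulVec u u =
          (2 * (1 - v q)) • Matrix.vecMulVec u u := by
        rw [Matrix.vecMulVec_mul_vecMulVec, huu, Matrix.vecMulVec_smul]
      rw [hH]
      simp only [sub_mul, mul_sub, one_mul, mul_one, Matrix.smul_mul, Matrix.mul_smul, hsq,
        smul_smul]
      ext i j
      simp only [Matrix.sub_apply, Matrix.smul_apply, smul_eq_mul]
      field_simp
      ring
    let Hc : Matrix (Fin d) (Fin d) ℂ := (Rat.castHom ℂ).mapMatrix H
    have hstar : star Hc = Hc := by
      ext i j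
      rw [Matrix.star_apply]
      simp only [Hc, RingHom.mapMatrix_apply, Matrix.map_apply]
      have : H j i = H i j := congrFun (congrFun hHt i) j
      simp [this]
    have hmem : Hc ∈ Matrix.unitaryGroup (Fin d) ℂ := by
      rw [Matrix.mem_unitaryGroup_iff, hstar, ← map_mul, hHH, map_one]
    refine ⟨⟨⟨Hc, hmem⟩, fun i j => ?_⟩, fun i => ?_⟩
    · exact isAlgebraic_algebraMap (H i j)
    · have : H i q = v i := by
        have huq : u q = 1 - v q := by simp [hu]
        rw [hH, Matrix.sub_apply, Matrix.smul_apply, Matrix.vecMulVec_apply, huq, smul_eq_mul,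
          mul_comm, mul_assoc, mul_inv_cancel₀ h1, mul_one, hu, Pi.sub_apply, Matrix.one_apply,
          Pi.single_apply]
        ring
      change ((H i q : ℚ) : ℂ) = v i
      rw [this]

theorem exists_algebraicUnitary_reset {d : ℕ} (q j : Fin d) :
    ∃ V : algebraicUnitaryGroup d, ∀ r, r ≠ q → (V.1 : Matrix (Fin d) (Fin d) ℂ) r j = 0 := by
  obtain ⟨V, hV⟩ := exists_algebraicUnitary_col q (Pi.single j 1) (by simp)
  refine ⟨V⁻¹, fun r hr => ?_⟩
  have h : ((V⁻¹ * V).1 : Matrix (Fin d) (Fin d) ℂ) r q = 0 := by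
    rw [inv_mul_cancel]
    exact Matrix.one_apply_ne hr
  change ((V⁻¹.1 : Matrix (Fin d) (Fin d) ℂ) * (V.1 : Matrix (Fin d) (Fin d) ℂ)) r q = 0 at h
  rw [Matrix.mul_apply, Finset.sum_eq_single j] at h
  · rw [hV j] at h
    simpa using h
  · intro s _ hs
    rw [hV s, Pi.single_eq_of_ne hs, Rat.cast_zero, mul_zero]
  · simp

/-- There are coins of arbitrarily small nonzero success probability, unless the register has only
one basis state. -/
theorem exists_algebraicUnitary_coin {d : ℕ} (q : Fin d) (δ : ℝ) (hδ : 0 < δ) :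
    ∃ V : algebraicUnitaryGroup d, (V.1 : Matrix (Fin d) (Fin d) ℂ) q q ≠ 0 ∧
      (2 ≤ d → ‖(V.1 : Matrix (Fin d) (Fin d) ℂ) q q‖ ^ 2 ≤ δ) := by
  by_cases hd : 2 ≤ d
  · have : Nontrivial (Fin d) := Fin.nontrivial_iff_two_le.2 hd
    obtain ⟨r, hr⟩ := exists_ne q
    obtain ⟨m, hm⟩ := exists_nat_gt (max 1 (4 / δ))
    have hm1 : (1 : ℝ) < m := (le_max_left _ _).trans_lt hm
    have hm2 : 4 / δ < m := (le_max_right _ _).trans_lt hm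
    have hm0 : (0 : ℚ) < m := by
      have : (0 : ℝ) < m := by linarith
      exact_mod_cast this
    have hden : (m : ℚ) ^ 2 + 1 ≠ 0 := by positivity
    -- the rational points `(2m, m² - 1) / (m² + 1)` of the unit circle
    set x : ℚ := 2 * m / (m ^ 2 + 1) with hx
    set y : ℚ := (m ^ 2 - 1) / (m ^ 2 + 1) with hy
    obtain ⟨V, hV⟩ := exists_algebraicUnitary_col q (Pi.single q x + Pi.single r y) (by
      simp [hr.symm]
      rw [hx, hy]
      field_simp
      ring)
    refine ⟨V, ?_, fun _ => ?_⟩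
    · rw [hV q]
      have : x ≠ 0 := by positivity
      simpa [hr.symm] using this
    · rw [hV q]
      have e : ((Pi.single q x + Pi.single r y : Fin d → ℚ) q : ℂ) = ((x : ℝ) : ℂ) := by
        simp [hr.symm]
      rw [e, Complex.norm_real, Real.norm_eq_abs, sq_abs, hx]
      push_cast
      rw [div_pow, div_le_iff₀ (by positivity)]
      rw [div_lt_iff₀ hδ] at hm2
      have : 4 * (m : ℝ) ^ 2 ≤ m ^ 3 * δ := by nlinarith [sq_nonneg (m : ℝ)]
      have h3 : (m : ℝ) ^ 3 ≤ (m ^ 2 + 1) ^ 2 := by nlinarith [sq_nonneg ((m : ℝ) ^ 2 - m)]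
      nlinarith
  · refine ⟨1, ?_, fun h => absurd h hd⟩
    change (1 : Matrix (Fin d) (Fin d) ℂ) q q ≠ 0
    simp

theorem unitary_sum_norm_sq_col {d : ℕ} (M : Matrix.unitaryGroup (Fin d) ℂ) (j : Fin d) :
    ∑ i, ‖(M : Matrix (Fin d) (Fin d) ℂ) i j‖ ^ 2 = 1 := by
  have h := congrFun (congrFun (Matrix.UnitaryGroup.star_mul_self M) j) j
  rw [Matrix.mul_apply, Matrix.one_apply_eq] at h
  have h2 : ∀ i, star (M : Matrix (Fin d) (Fin d) ℂ) j i * (M : Matrix (Fin d) (Fin d) ℂ) i j =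
      ((‖(M : Matrix (Fin d) (Fin d) ℂ) i j‖ ^ 2 : ℝ) : ℂ) := by
    intro i
    rw [Matrix.star_apply]
    push_cast
    exact Complex.conj_mul' _
  simp only [h2] at h
  exact_mod_cast h

theorem norm_apply_of_mem_center {d : ℕ} {M : algebraicUnitaryGroup d}
    (hM : M ∈ Subgroup.center (algebraicUnitaryGroup d)) (q : Fin d) :
    ‖(M.1 : Matrix (Fin d) (Fin d) ℂ) q q‖ = 1 := by
  -- `M` commutes with the reflection that changes the sign of the coordinate `q`
  let D : Matrix (Fin d) (Fin d) ℂ := Matrix.diagonal (Function.update 1 q (-1))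
  have hD : D ∈ Matrix.unitaryGroup (Fin d) ℂ := by
    rw [Matrix.mem_unitaryGroup_iff, Matrix.star_eq_conjTranspose, Matrix.diagonal_conjTranspose,
      Matrix.diagonal_mul_diagonal, ← Matrix.diagonal_one]
    congr 1
    ext i
    by_cases hi : i = q
    · subst hi; simp
    · simp [hi]
  have hDalg : (⟨D, hD⟩ : Matrix.unitaryGroup (Fin d) ℂ) ∈ algebraicUnitaryGroup d := by
    intro i j
    change IsAlgebraic ℚ (D i j)
    simp only [D, Matrix.diagonal_apply, Function.update_apply, Pi.one_apply]
    split_ifs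
    · exact isAlgebraic_one.neg
    · exact isAlgebraic_one
    · exact isAlgebraic_zero
  have hcomm := Subgroup.mem_center_iff.1 hM ⟨⟨D, hD⟩, hDalg⟩
  have hmat : D * (M.1 : Matrix (Fin d) (Fin d) ℂ) = (M.1 : Matrix (Fin d) (Fin d) ℂ) * D :=
    congrArg (fun N : algebraicUnitaryGroup d => (N.1 : Matrix (Fin d) (Fin d) ℂ)) hcomm
  have hoff : ∀ i, i ≠ q → (M.1 : Matrix (Fin d) (Fin d) ℂ) i q = 0 := by
    intro i hi
    have := congrFun (congrFun hmat i) q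
    rw [Matrix.diagonal_mul, Matrix.mul_diagonal] at this
    simp [hi] at this
    exact self_eq_neg.1 this
  have h := unitary_sum_norm_sq_col M.1 q
  rw [Finset.sum_eq_single q (fun i _ hi => by simp [hoff i hi]) (by simp)] at h
  exact (pow_eq_one_iff_of_nonneg (norm_nonneg _) two_ne_zero).1 h

/-- The unit vectors `|a⟩` and `(3|a⟩ + 4|b⟩)/5`: a matrix that has all of them as eigenvectors is
scalar. -/
def testVector {d : ℕ} (a b : Fin d) : Fin d → ℚ :=
  if a = b then Pi.single a 1 else Pi.single a (3 / 5) + Pi.single b (4 / 5)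

theorem testVector_dotProduct_self {d : ℕ} (a b : Fin d) :
    testVector a b ⬝ᵥ testVector a b = 1 := by
  rw [testVector]
  split_ifs with h
  · simp
  · simp [h, Ne.symm h]
    norm_num

theorem conj_apply_eq_sum {d : ℕ} (V M : algebraicUnitaryGroup d) (q : Fin d) (v : Fin d → ℚ)
    (hV : ∀ i, (V.1 : Matrix (Fin d) (Fin d) ℂ) i q = v i) :
    ((V⁻¹ * M * V).1 : Matrix (Fin d) (Fin d) ℂ) q q =
      ∑ j, ∑ i, v i * (M.1 : Matrix (Fin d) (Fin d) ℂ) i j * v j := by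
  change ((star (V.1 : Matrix (Fin d) (Fin d) ℂ) * (M.1 : Matrix (Fin d) (Fin d) ℂ)) *
    (V.1 : Matrix (Fin d) (Fin d) ℂ)) q q = _
  rw [Matrix.mul_apply]
  refine Finset.sum_congr rfl fun j _ => ?_
  rw [Matrix.mul_apply, Finset.sum_mul, hV]
  refine Finset.sum_congr rfl fun i _ => ?_
  rw [Matrix.star_apply, hV]
  simp

theorem norm_sq_three_four (x y : ℂ) (hx : ‖x‖ = 1) (hy : ‖y‖ = 1) :
    ‖(9 * x + 16 * y) / 25‖ ^ 2 = 1 - 144 / 625 * ‖x - y‖ ^ 2 := by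
  have hx' : Complex.normSq x = 1 := by rw [Complex.normSq_eq_norm_sq, hx, one_pow]
  have hy' : Complex.normSq y = 1 := by rw [Complex.normSq_eq_norm_sq, hy, one_pow]
  rw [norm_div, div_pow, ← Complex.normSq_eq_norm_sq, ← Complex.normSq_eq_norm_sq,
    ← Complex.normSq_eq_norm_sq]
  simp only [Complex.normSq_apply] at *
  simp
  linear_combination (9 * 9 / 625 + 144 / 625) * hx' + (256 / 625 + 144 / 625) * hy'

/-- If the off-diagonal entries of a unitary matrix, and the differences of its diagonal entries,
are at least `δ` in absolute value as soon as they do not vanish, then either the matrix is central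
or a test detects that it is not, with probability of the order of `δ ^ 2`. -/
theorem exists_test_of_notMem_center {d : ℕ} (M : algebraicUnitaryGroup d)
    (hM : M ∉ Subgroup.center (algebraicUnitaryGroup d)) (q : Fin d) (δ : ℝ) (hδ : 0 ≤ δ)
    (hoff : ∀ i j, (M.1 : Matrix (Fin d) (Fin d) ℂ) i j ≠ 0 →
      δ ≤ ‖(M.1 : Matrix (Fin d) (Fin d) ℂ) i j‖)
    (hdiag : ∀ i j,
      (M.1 : Matrix (Fin d) (Fin d) ℂ) i i - (M.1 : Matrix (Fin d) (Fin d) ℂ) j j ≠ 0 →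
      δ ≤ ‖(M.1 : Matrix (Fin d) (Fin d) ℂ) i i - (M.1 : Matrix (Fin d) (Fin d) ℂ) j j‖) :
    ∃ a b, ∀ V : algebraicUnitaryGroup d,
      (∀ i, (V.1 : Matrix (Fin d) (Fin d) ℂ) i q = testVector a b i) →
      ‖((V⁻¹ * M * V).1 : Matrix (Fin d) (Fin d) ℂ) q q‖ ^ 2 ≤ 1 - 144 / 625 * δ ^ 2 := by
  set A := (M.1 : Matrix (Fin d) (Fin d) ℂ) with hA
  have hcol := unitary_sum_norm_sq_col M.1
  by_cases h1 : ∃ a b, b ≠ a ∧ A b a ≠ 0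
  · obtain ⟨a, b, hab, hb⟩ := h1
    refine ⟨a, a, fun V hV => ?_⟩
    rw [conj_apply_eq_sum V M q _ hV]
    have e : ∑ j, ∑ i, (testVector a a i : ℂ) * A i j * testVector a a j = A a a := by
      rw [Finset.sum_eq_single a, Finset.sum_eq_single a]
      all_goals simp +contextual [testVector]
    rw [e]
    have h2 : ‖A a a‖ ^ 2 + ‖A b a‖ ^ 2 ≤ 1 := by
      rw [← hcol a, ← Finset.sum_pair (f := fun i => ‖A i a‖ ^ 2) hab.symm]
      exact Finset.sum_le_sum_of_subset_of_nonneg (Finset.subset_univ _) fun _ _ _ => by positivity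
    have h3 : δ ^ 2 ≤ ‖A b a‖ ^ 2 := pow_le_pow_left₀ hδ (hoff b a hb) 2
    nlinarith [sq_nonneg δ]
  · push Not at h1
    have hnorm : ∀ a, ‖A a a‖ = 1 := by
      intro a
      have h := hcol a
      rw [Finset.sum_eq_single a (fun i _ hi => by simp [← hA, h1 a i hi]) (by simp)] at h
      exact (pow_eq_one_iff_of_nonneg (norm_nonneg _) two_ne_zero).1 h
    by_cases h2 : ∃ a b, A a a - A b b ≠ 0
    · obtain ⟨a, b, hab⟩ := h2
      have hne : a ≠ b := by
        rintro rfl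
        simp at hab
      refine ⟨a, b, fun V hV => ?_⟩
      rw [conj_apply_eq_sum V M q _ hV]
      have e : ∑ j, ∑ i, (testVector a b i : ℂ) * A i j * testVector a b j =
          (9 * A a a + 16 * A b b) / 25 := by
        have e1 : ∀ j, ∑ i, (testVector a b i : ℂ) * A i j * testVector a b j =
            testVector a b j ^ 2 * A j j := by
          intro j
          rw [Finset.sum_eq_single j (fun i _ hi => by simp [h1 j i hi]) (by simp)]
          ring
        simp only [e1]
        rw [Fintype.sum_eq_add a b hne]
        · simp [testVector, hne, hne.symm]
          ring
        · rintro j ⟨hja, hjb⟩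
          simp [testVector, hne, hja, hjb]
      rw [e, norm_sq_three_four _ _ (hnorm a) (hnorm b)]
      have h3 : δ ^ 2 ≤ ‖A a a - A b b‖ ^ 2 := pow_le_pow_left₀ hδ (hdiag a b hab) 2
      linarith
    · push Not at h2
      refine absurd (Subgroup.mem_center_iff.2 fun N => ?_) hM
      have hscalar : A = A q q • (1 : Matrix (Fin d) (Fin d) ℂ) := by
        ext i j
        by_cases hij : i = j
        · subst hij
          simpa using sub_eq_zero.1 (h2 i q)
        · simp [hij, h1 j i hij]
      apply Subtype.ext
      apply Subtype.ext
      change (N.1 : Matrix (Fin d) (Fin d) ℂ) * A = A * (N.1 : Matrix (Fin d) (Fin d) ℂ)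
      rw [hscalar, Matrix.mul_smul, Matrix.smul_mul, mul_one, one_mul]

/-! ### A Liouville bound for products of algebraic matrices -/

/-- Liouville's inequality: a nonzero element of a number field with bounded denominator and bounded
conjugates is bounded away from zero, since the norm of its integral multiple is a nonzero
integer. -/
theorem NumberField.one_le_norm_mul_pow {K : Type*} [Field K] [NumberField K] (σ : K →+* ℂ) {x : K}
    (hx : x ≠ 0) {y : ℤ} (hy : y ≠ 0) (hint : IsIntegral ℤ (y • x)) {B : ℝ} (hB : 1 ≤ B)
    (hhouse : house x ≤ B) : 1 ≤ ‖σ x‖ * (|(y : ℝ)| * B) ^ Module.finrank ℚ K := by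
  have hy1 : (1 : ℝ) ≤ |(y : ℝ)| := by exact_mod_cast Int.one_le_abs hy
  have hne : y • x ≠ 0 := smul_ne_zero hy hx
  have hnorm : (1 : ℝ) ≤ ‖Algebra.norm ℚ (y • x)‖ := by
    obtain ⟨m, hm⟩ := IsIntegrallyClosed.isIntegral_iff.1 (Algebra.isIntegral_norm ℚ hint)
    have hm0 : m ≠ 0 := by
      rintro rfl
      rw [map_zero] at hm
      exact hne (Algebra.norm_eq_zero_iff.1 hm.symm)
    rw [← hm, eq_intCast, ← Rat.norm_cast_real, Rat.cast_intCast, Real.norm_eq_abs]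
    exact_mod_cast Int.one_le_abs hm0
  have hyx : house (y • x) ≤ |(y : ℝ)| * B := by
    rw [zsmul_eq_mul]
    refine (house_mul_le _ _).trans ?_
    rw [house_intCast]
    push_cast
    gcongr
  have hσ : ‖σ (y • x)‖ = |(y : ℝ)| * ‖σ x‖ := by
    rw [zsmul_eq_mul, map_mul, map_intCast, norm_mul, Complex.norm_intCast]
  calc (1 : ℝ) ≤ ‖σ (y • x)‖ * house (y • x) ^ (Module.finrank ℚ K - 1) :=
        hnorm.trans (norm_norm_le_norm_mul_house_pow _ σ)
    _ ≤ (|(y : ℝ)| * B * ‖σ x‖) * (|(y : ℝ)| * B) ^ (Module.finrank ℚ K - 1) := by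
        rw [hσ]
        gcongr
        · exact pow_nonneg (house_nonneg _) _
        · nlinarith [norm_nonneg (σ x)]
        · exact house_nonneg _
    _ = ‖σ x‖ * ((|(y : ℝ)| * B) ^ (Module.finrank ℚ K - 1) * (|(y : ℝ)| * B)) := by ring
    _ = _ := by rw [← pow_succ, Nat.sub_add_cancel Module.finrank_pos]

/-- Denominators and conjugates of the entries of a product of `n` matrices from a finite family
grow at most exponentially in `n`. -/
theorem NumberField.exists_bound_prod_entries {K : Type*} [Field K] [NumberField K] {ι : Type*}
    [Finite ι] {d : ℕ} (A : ι → Matrix (Fin d) (Fin d) K) :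
    ∃ (y : ℤ) (B : ℝ), y ≠ 0 ∧ 1 ≤ B ∧ ∀ (l : List ι) (i j : Fin d),
      IsIntegral ℤ (y ^ l.length • (l.map A).prod i j) ∧
        house ((l.map A).prod i j) ≤ B ^ l.length := by
  classical
  have := Fintype.ofFinite ι
  let s : Finset K := Finset.univ.image fun p : ι × Fin d × Fin d => A p.1 p.2.1 p.2.2
  have hs : ∀ a i j, A a i j ∈ s := fun a i j =>
    Finset.mem_image.2 ⟨(a, i, j), Finset.mem_univ _, rfl⟩
  have : Algebra.IsAlgebraic ℤ K := (IsFractionRing.comap_isAlgebraic_iff (K := ℚ)).2 inferInstance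
  obtain ⟨y, hy, hyint⟩ := Algebra.IsAlgebraic.exists_integral_multiples ℤ s
  set b : ℝ := ∑ x ∈ s, house x with hb
  have hle : ∀ a i j, house (A a i j) ≤ b := fun a i j =>
    Finset.single_le_sum (f := fun x => house x) (fun x _ => house_nonneg x) (hs a i j)
  have hb0 : 0 ≤ b := Finset.sum_nonneg fun x _ => house_nonneg x
  refine ⟨y, d * b + 1, hy, by nlinarith [mul_nonneg (Nat.cast_nonneg (α := ℝ) d) hb0], ?_⟩
  intro l
  induction l with
  | nil =>
    intro i j
    rw [List.map_nil, List.prod_nil, List.length_nil, pow_zero, pow_zero, one_smul,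
      Matrix.one_apply]
    split_ifs
    · exact ⟨isIntegral_one, by simpa using (house_intCast (K := K) 1).le⟩
    · refine ⟨isIntegral_zero, ?_⟩
      have := (house_intCast (K := K) 0).le
      simp only [Int.cast_zero, abs_zero] at this
      linarith
  | cons a l ih =>
    intro i j
    rw [List.map_cons, List.prod_cons, Matrix.mul_apply, List.length_cons]
    constructor
    · rw [Finset.smul_sum]
      refine IsIntegral.sum _ fun k _ => ?_
      rw [pow_succ', ← smul_mul_smul_comm]
      exact (hyint _ (hs a i k)).mul (ih k j).1
    · refine (house_sum_le_sum_house _ _).trans ?_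
      calc ∑ k, house (A a i k * (l.map A).prod k j)
          ≤ ∑ _k : Fin d, b * (d * b + 1) ^ l.length := by
            refine Finset.sum_le_sum fun k _ => (house_mul_le _ _).trans ?_
            exact mul_le_mul (hle a i k) (ih k j).2 (house_nonneg _) hb0
        _ = (d * b) * (d * b + 1) ^ l.length := by
            rw [Finset.sum_const, Finset.card_univ, Fintype.card_fin, nsmul_eq_mul]
            ring
        _ ≤ (d * b + 1) ^ (l.length + 1) := by
            rw [pow_succ']
            gcongr
            linarith

/-- The nonzero entries of products of `n` matrices from a finite family of matrices with algebraic
entries are at least exponentially small in `n`, and so are the nonzero differences of entries. -/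
theorem exists_lower_bound_prod_entries {ι : Type*} [Finite ι] {d : ℕ}
    (A : ι → Matrix (Fin d) (Fin d) ℂ) (hA : ∀ a i j, IsAlgebraic ℚ (A a i j)) :
    ∃ c : ℝ, 0 < c ∧ c ≤ 1 ∧ ∀ l : List ι,
      (∀ i j, (l.map A).prod i j ≠ 0 → c ^ (l.length + 1) ≤ ‖(l.map A).prod i j‖) ∧
      (∀ i j, (l.map A).prod i i - (l.map A).prod j j ≠ 0 →
        c ^ (l.length + 1) ≤ ‖(l.map A).prod i i - (l.map A).prod j j‖) := by
  let S : Set ℂ := Set.range fun p : ι × Fin d × Fin d => A p.1 p.2.1 p.2.2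
  have hS : S.Finite := Set.finite_range _
  let K := IntermediateField.adjoin ℚ S
  have : FiniteDimensional ℚ K := by
    have := hS.to_subtype
    refine IntermediateField.finiteDimensional_adjoin fun x hx => ?_
    obtain ⟨p, rfl⟩ := hx
    exact (hA _ _ _).isIntegral
  have : NumberField K := ⟨⟩
  let σ : K →+* ℂ := algebraMap K ℂ
  let A' : ι → Matrix (Fin d) (Fin d) K := fun a => Matrix.of fun i j =>
    ⟨A a i j, IntermediateField.subset_adjoin ℚ S ⟨(a, i, j), rfl⟩⟩
  have hprod : ∀ (l : List ι) i j, (l.map A).prod i j = σ ((l.map A').prod i j) := by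
    intro l i j
    have : (l.map A).prod = σ.mapMatrix (l.map A').prod := by
      rw [map_list_prod, List.map_map]
      rfl
    rw [this]
    rfl
  obtain ⟨y, B, hy, hB, h⟩ := NumberField.exists_bound_prod_entries A'
  have hy1 : (1 : ℝ) ≤ |(y : ℝ)| := by exact_mod_cast Int.one_le_abs hy
  set D := Module.finrank ℚ K
  set C : ℝ := 2 * |(y : ℝ)| * B with hC
  have hC1 : 1 ≤ C := by nlinarith
  have key : ∀ (n : ℕ) (x : K), x ≠ 0 → IsIntegral ℤ (y ^ n • x) →
      NumberField.house x ≤ 2 * B ^ n → ((C ^ D)⁻¹) ^ (n + 1) ≤ ‖σ x‖ := by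
    intro n x hx hint hx2
    have hBn : 1 ≤ B ^ n := one_le_pow₀ hB
    have h1 := NumberField.one_le_norm_mul_pow σ hx (pow_ne_zero n hy) hint (by linarith) hx2
    have h2 : |((y ^ n : ℤ) : ℝ)| * (2 * B ^ n) ≤ C ^ (n + 1) := by
      rw [hC, mul_pow, mul_pow, Int.cast_pow, abs_pow]
      have e1 : |(y : ℝ)| ^ n ≤ |(y : ℝ)| ^ (n + 1) := pow_le_pow_right₀ hy1 n.le_succ
      have e2 : B ^ n ≤ B ^ (n + 1) := pow_le_pow_right₀ hB n.le_succ
      have e3 : (2 : ℝ) ≤ 2 ^ (n + 1) := by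
        simpa using pow_le_pow_right₀ (one_le_two (α := ℝ)) (Nat.le_add_left 1 n)
      calc |(y : ℝ)| ^ n * (2 * B ^ n) = 2 * |(y : ℝ)| ^ n * B ^ n := by ring
        _ ≤ _ := by gcongr
    rw [inv_pow, inv_le_iff_one_le_mul₀ (by positivity), ← pow_mul, mul_comm D, pow_mul]
    exact h1.trans (by gcongr)
  refine ⟨(C ^ D)⁻¹, by positivity, inv_le_one_of_one_le₀ (one_le_pow₀ hC1), fun l => ⟨?_, ?_⟩⟩
  · intro i j hij
    rw [hprod] at hij ⊢
    refine key _ _ (fun h0 => hij (by rw [h0, map_zero])) (h l i j).1 ((h l i j).2.trans ?_)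
    linarith [pow_nonneg (zero_le_one.trans hB) l.length]
  · intro i j hij
    rw [hprod, hprod, ← map_sub] at hij ⊢
    refine key _ _ (fun h0 => hij (by rw [h0, map_zero])) ?_ ?_
    · rw [smul_sub]
      exact (h l i i).1.sub (h l j j).1
    · have hneg : NumberField.house (-(l.map A').prod j j) =
          NumberField.house ((l.map A').prod j j) := by
        rw [NumberField.house, map_neg, norm_neg, NumberField.house]
      rw [sub_eq_add_neg]
      refine (NumberField.house_add_le _ _).trans ?_
      rw [hneg]
      linarith [(h l i i).2, (h l j j).2]

/-! ### Word problems of virtual subgroups of `PU(d, ℚ̄)ᵏ` -/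

/-- Reidemeister–Schreier rewriting for a normal subgroup `N` of finite index: while a finite
automaton follows the class of the prefix in `G ⧸ N`, each letter contributes an element of `N`, and
for a word that represents `g ∈ N` the contributions multiply to a conjugate of `g⁻¹`. -/
theorem exists_automaton_of_normal {G A : Type*} [Group G] (N : Subgroup G) [N.Normal]
    [N.FiniteIndex] (val : A → G) :
    ∃ (X : Type) (_ : Finite X) (x₀ : X) (track : X → A → X) (η : X → A → N), ∀ w : List A,
      (w.foldl track x₀ = x₀ ↔ (w.map val).prod ∈ N) ∧
      (w.foldl track x₀ = x₀ → (((scanned track x₀ w).map fun p => η p.1 p.2).prod = 1 ↔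
        (w.map val).prod = 1)) := by
  have E : G ⧸ N ≃ Fin (Nat.card (G ⧸ N)) := Finite.equivFin _
  let track : Fin (Nat.card (G ⧸ N)) → A → Fin (Nat.card (G ⧸ N)) :=
    fun x a => E (E.symm x * (val a : G ⧸ N))
  let s : Fin (Nat.card (G ⧸ N)) → G := fun x => (E.symm x).out
  have hs : ∀ x, (s x : G ⧸ N) = E.symm x := fun x => Quotient.out_eq' _
  let η : Fin (Nat.card (G ⧸ N)) → A → N := fun x a =>
    ⟨s (track x a) * (val a)⁻¹ * (s x)⁻¹, by
      rw [← QuotientGroup.eq_one_iff]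
      rw [QuotientGroup.mk_mul, QuotientGroup.mk_mul, QuotientGroup.mk_inv, QuotientGroup.mk_inv,
        hs, hs]
      simp [track]⟩
  have hfold : ∀ (w : List A) x,
      E.symm (w.foldl track x) = E.symm x * ((w.map val).prod : G) := by
    intro w
    induction w with
    | nil => simp
    | cons a w ih =>
      intro x
      rw [List.foldl_cons, ih, List.map_cons, List.prod_cons]
      simp [track, mul_assoc]
  have hprod : ∀ (w : List A) x,
      ((((scanned track x w).map fun p => η p.1 p.2).prod : N) : G) =
        s (w.foldl track x) * (w.map val).prod⁻¹ * (s x)⁻¹ := by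
    intro w
    induction w with
    | nil => simp [scanned]
    | cons a w ih =>
      intro x
      rw [scanned, List.map_append, List.prod_append, Subgroup.coe_mul, ih]
      simp [η, mul_assoc]
  refine ⟨_, inferInstance, E 1, track, η, fun w => ⟨?_, fun hw => ?_⟩⟩
  · rw [← E.symm.injective.eq_iff, hfold, E.symm_apply_apply, one_mul, QuotientGroup.eq_one_iff]
  · rw [← OneMemClass.coe_eq_one, hprod, hw, conj_eq_one_iff, inv_eq_one]

theorem mem_center_of_lt_two {d : ℕ} (hd : d < 2) (M : algebraicUnitaryGroup d) :
    M ∈ Subgroup.center (algebraicUnitaryGroup d) := by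
  have : Subsingleton (Fin d) := Fin.subsingleton_iff_le_one.2 (by omega)
  refine Subgroup.mem_center_iff.2 fun N => Subtype.ext (Subtype.ext ?_)
  change (N.1 : Matrix (Fin d) (Fin d) ℂ) * (M.1 : Matrix (Fin d) (Fin d) ℂ) =
    (M.1 : Matrix (Fin d) (Fin d) ℂ) * (N.1 : Matrix (Fin d) (Fin d) ℂ)
  ext i j
  rw [Matrix.mul_apply, Matrix.mul_apply]
  refine Finset.sum_congr rfl fun l _ => ?_
  rw [Subsingleton.elim l i, Subsingleton.elim j i, mul_comm]

theorem linear_div_pow_le_ofReal {p : ℝ} (hp₀ : 0 < p) (n : ℕ) :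
    (3 * n + 7 : ℝ≥0∞) / ENNReal.ofReal p ^ (n + 2) ≤ ENNReal.ofReal (7 / p ^ 2 * (2 / p) ^ n) := by
  have h1 : (3 * n + 7 : ℝ≥0∞) = ENNReal.ofReal (3 * n + 7) := by
    rw [ENNReal.ofReal_add (by positivity) (by norm_num), ENNReal.ofReal_mul (by norm_num)]
    simp
  have h2 : (n : ℝ) + 1 ≤ 2 ^ n := by exact_mod_cast Nat.lt_two_pow_self
  rw [h1, ← ENNReal.ofReal_pow hp₀.le, ← ENNReal.ofReal_div_of_pos (by positivity)]
  refine ENNReal.ofReal_le_ofReal ?_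
  rw [div_le_iff₀ (by positivity)]
  have e : 7 / p ^ 2 * (2 / p) ^ n * p ^ (n + 2) = 7 * 2 ^ n := by
    rw [div_pow, pow_add]
    field_simp
  rw [e]
  linarith

theorem theorem3 {G : Type*} [Group G] (hfg : Group.FG G)
    (d k : ℕ) (hd : 1 ≤ d) (hk : 1 ≤ k)
    (hG : IsVirtuallySubgroupOf G (Fin k → AlgebraicPU d))
    {S : Type*} [Finite S] (R : Set (FreeGroup S)) (e : PresentedGroup R ≃* G)
    (ε : ℝ) (hε : 0 < ε) :
    ∃ D : ℝ, 1 ≤ D ∧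
      wordProblem R ∈ CoR2QCFA (fun n => D ^ n) ε d algebraicNumbers := by
  obtain ⟨H, hH, f, hf⟩ := hG
  let val : S × Bool → G := fun a =>
    e (if a.2 then PresentedGroup.of a.1 else (PresentedGroup.of a.1)⁻¹)
  have hval : ∀ w : List (S × Bool), w ∈ wordProblem R ↔ (w.map val).prod = 1 := by
    intro w
    change (w.map _).prod = 1 ↔ _
    rw [← e.map_eq_one_iff, map_list_prod, List.map_map]
    rfl
  obtain ⟨X, hX, x₀, track, η, hη⟩ := exists_automaton_of_normal H.normalCore val
  -- lifts to `U(d)` of the components in `PU(d)` of the contributions of the letters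
  let u : Fin k → X → S × Bool → algebraicUnitaryGroup d := fun κ x a =>
    (f (Subgroup.inclusion H.normalCore_le (η x a)) κ).out
  have hu : ∀ κ w, ((((scanned track x₀ w).map fun p => u κ p.1 p.2).prod :
      algebraicUnitaryGroup d) : AlgebraicPU d) = f (Subgroup.inclusion H.normalCore_le
        ((scanned track x₀ w).map fun p => η p.1 p.2).prod) κ := by
    intro κ w
    change QuotientGroup.mk' _ _ = (Pi.evalMonoidHom _ κ).comp
      (f.comp (Subgroup.inclusion H.normalCore_le)) _
    rw [map_list_prod, map_list_prod, List.map_map, List.map_map]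
    congr 1
    refine List.map_congr_left fun p _ => ?_
    exact Quotient.out_eq' _
  obtain ⟨c, hc₀, hc₁, hc⟩ := exists_lower_bound_prod_entries
    (fun p : Fin k × X × (S × Bool) => ((u p.1 p.2.1 p.2.2).1 : Matrix (Fin d) (Fin d) ℂ))
    fun p => (u p.1 p.2.1 p.2.2).2
  let q₀ : Fin d := ⟨0, hd⟩
  let N := Fintype.card (Fin k × Fin d × Fin d)
  have : Nonempty (Fin k × Fin d × Fin d) := ⟨⟨0, hk⟩, q₀, q₀⟩
  have : NeZero N := ⟨Fintype.card_ne_zero⟩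
  have hN : (0 : ℝ) < N := by exact_mod_cast Fintype.card_pos
  have E : ZMod N ≃ Fin k × Fin d × Fin d := Fintype.equivOfCardEq (ZMod.card N)
  choose V hV using fun a b : Fin d =>
    exists_algebraicUnitary_col q₀ (testVector a b) (testVector_dotProduct_self a b)
  choose r hr using exists_algebraicUnitary_reset q₀
  -- the coin is small compared with the failure probability `144 / 625 * c ^ (2 * (n + 1))`
  obtain ⟨F, hF₀, hF⟩ := exists_algebraicUnitary_coin q₀ (min (c ^ 2) (144 / 625 * ε / N))
    (by positivity)
  let P : TestFamily d N X (S × Bool) :=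
    { q₀ := q₀
      x₀ := x₀
      track := track
      good := fun x => x = x₀
      gate := fun i => u (E i).1
      prep := fun i => V (E i).2.1 (E i).2.2
      coin := F
      reset := r
      reset_apply := hr }
  set p : ℝ := ‖(F.1 : Matrix (Fin d) (Fin d) ℂ) q₀ q₀‖ ^ 2 with hp
  have hp₀ : 0 < p := by positivity
  have hPp : P.coinProb = ENNReal.ofReal p := rfl
  have hcoin : P.coinProb ≠ 0 := by rw [hPp]; simpa using hp₀
  have hp₁ : p ≤ 1 := by
    have := P.coinProb_le_one
    rwa [hPp, ENNReal.ofReal_le_one] at this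
  refine ⟨2 / p, by rw [le_div_iff₀ hp₀]; linarith, SweepState d N X, inferInstance, P.machine,
    P.amplitudes_machine, ⟨7 / p ^ 2, fun w => ?_⟩, fun w => ?_⟩
  · refine (P.expectedTime_machine_le w hcoin).trans ?_
    rw [hPp]
    exact linear_div_pow_le_ofReal hp₀ w.length
  have hsum : P.machine.probAccept w + P.machine.probReject w = 1 := by
    refine P.machine.probAccept_add_probReject w
      (ne_top_of_le_ne_top ?_ (P.expectedTime_machine_le w hcoin))
    rw [hPp]
    exact ne_top_of_le_ne_top ENNReal.ofReal_ne_top (linear_div_pow_le_ofReal hp₀ w.length)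
  refine ⟨hsum, fun hw => ?_, fun hw => ?_⟩
  · rw [hval] at hw
    have hgood : w.foldl track x₀ = x₀ := (hη w).1.2 (by rw [hw]; exact one_mem _)
    have hone := ((hη w).2 hgood).2 hw
    have hrej : P.machine.probReject w = 0 := by
      refine P.probReject_machine_eq_zero w hcoin fun i => ?_
      have hmem : P.run i P.x₀ w ∈ Subgroup.center (algebraicUnitaryGroup d) := by
        rw [← QuotientGroup.eq_one_iff]
        refine (hu (E i).1 w).trans ?_
        rw [hone, map_one, map_one]
        rfl
      have hmem' : P.testUnitary i w ∈ Subgroup.center (algebraicUnitaryGroup d) := by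
        have := (inferInstance : (Subgroup.center (algebraicUnitaryGroup d)).Normal).conj_mem _ hmem
          (P.prep i)⁻¹
        rwa [inv_inv] at this
      rw [TestFamily.pass, if_pos hgood, TestFamily.passProb, norm_apply_of_mem_center hmem']
      simp
    rwa [hrej, add_zero] at hsum
  · rw [hval] at hw
    have hacc : P.machine.probAccept w ≤ ENNReal.ofReal ε := by
      by_cases hgood : w.foldl track x₀ = x₀
      · have hne := mt ((hη w).2 hgood).1 hw
        have hfne : f (Subgroup.inclusion H.normalCore_le
            ((scanned track x₀ w).map fun p => η p.1 p.2).prod) ≠ 1 := by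
          rw [Ne, map_eq_one_iff f hf, map_eq_one_iff _ (Subgroup.inclusion_injective _)]
          exact hne
        obtain ⟨κ, hκ⟩ := Function.ne_iff.1 hfne
        set M := ((scanned track x₀ w).map fun p => u κ p.1 p.2).prod with hM
        have hMc : M ∉ Subgroup.center (algebraicUnitaryGroup d) := by
          rw [← QuotientGroup.eq_one_iff, hu κ w]
          exact hκ
        have hd2 : 2 ≤ d := by
          by_contra hlt
          exact hMc (mem_center_of_lt_two (not_le.1 hlt) M)
        have hMl : (M.1 : Matrix (Fin d) (Fin d) ℂ) = (((scanned track x₀ w).map fun p =>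
            ((κ, p) : Fin k × X × (S × Bool))).map fun p =>
              ((u p.1 p.2.1 p.2.2).1 : Matrix (Fin d) (Fin d) ℂ)).prod := by
          change ((Matrix.unitaryGroup (Fin d) ℂ).subtype.comp
            (algebraicUnitaryGroup d).subtype) M = _
          rw [hM, map_list_prod, List.map_map, List.map_map]
          rfl
        have hlow := hc ((scanned track x₀ w).map fun p => (κ, p))
        rw [← hMl, List.length_map, length_scanned] at hlow
        obtain ⟨a, b, hab⟩ := exists_test_of_notMem_center M hMc q₀ (c ^ (w.length + 1))
          (by positivity) hlow.1 hlow.2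
        set ρ : ℝ := 144 / 625 * (c ^ (w.length + 1)) ^ 2 with hρ
        have hρ₀ : 0 < ρ := by positivity
        have hρ₁ : ρ ≤ 1 := by
          have : (c ^ (w.length + 1)) ^ 2 ≤ 1 :=
            pow_le_one₀ (by positivity) (pow_le_one₀ hc₀.le hc₁)
          linarith
        refine (P.probAccept_machine_le w (E.symm (κ, a, b)) (ENNReal.ofReal ρ) (by simpa using hρ₀)
          (ENNReal.ofReal_le_one.2 hρ₁) ?_).trans ?_
        · rw [TestFamily.pass, if_pos hgood, TestFamily.passProb, ← ENNReal.ofReal_one,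
            ← ENNReal.ofReal_sub _ hρ₀.le]
          refine ENNReal.ofReal_le_ofReal ?_
          have hV' := hab (V a b) (hV a b)
          have htest : P.testUnitary (E.symm (κ, a, b)) w = (V a b)⁻¹ * M * V a b := by
            simp only [TestFamily.testUnitary, TestFamily.run, P, Equiv.apply_symm_apply, hM]
          rw [htest]
          exact hV'
        · have hpδ := hF hd2
          have h1 : p ^ (w.length + 1) ≤ (c ^ 2) ^ (w.length + 1) :=
            pow_le_pow_left₀ hp₀.le (hpδ.trans (min_le_left _ _)) _
          have h2 : p * N ≤ 144 / 625 * ε := (le_div_iff₀ hN).1 (hpδ.trans (min_le_right _ _))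
          rw [hPp, ← ENNReal.ofReal_pow hp₀.le, ← ENNReal.ofReal_natCast,
            ← ENNReal.ofReal_mul hN.le, ← ENNReal.ofReal_div_of_pos hρ₀]
          refine ENNReal.ofReal_le_ofReal ?_
          rw [div_le_iff₀ hρ₀]
          calc N * p ^ (w.length + 2) = p ^ (w.length + 1) * (p * N) := by ring
            _ ≤ (c ^ 2) ^ (w.length + 1) * (144 / 625 * ε) := by gcongr
            _ = ε * ρ := by rw [hρ]; ring
      · rw [P.probAccept_machine_eq_zero w hgood]
        exact zero_le
    rw [ENNReal.ofReal_sub _ hε.le, ENNReal.ofReal_one, tsub_le_iff_left, ← hsum]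
    gcongr
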